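/- Notation. For $x,\xi\in\mathbb{R}^n$ let $T_xf(t)=f(t-x)$ and $M_\xi f(t)=f(t)e^{2\pi i t\cdot\xi}$. A translation-modulation invariant Banach space of distributions (TMIB) on $\mathbb{R}^n$ is a Banach space $E$ with dense continuous inclusions $\mathcal{S}(\mathbb{R}^n)\hookrightarrow E\hookrightarrow\mathcal{S}'(\mathbb{R}^n)$ such that $T_x(E)\subseteq E$ and $M_\xi(E)\subseteq E$ for all $x,\xi\in\mathbb{R}^n$ and such that there are $C,\tau>0$ with $\|T_x\|_{\mathcal{L}(E)}\le C(1+|x|)^\tau$ and $\|M_{-\xi}\|_{\mathcal{L}(E)}\le C(1+|\xi|)^\tau$ for all $x,\xi$. Its strong dual $E'$ is regarded as a subspace of $\mathcal{S}'(\mathbb{R}^n)$ by restricting functionals to $\mathcal{S}(\mathbb{R}^n)$. Let $B$ be a real $n\times n$-matrix, let $\Lambda$ be a lattice in $\mathbb{R}^n$ (a discrete subgroup that spans $\mathbb{R}^n$), and let $U$ be a bounded open neighbourhood of the origin such that the sets $\lambda+U$, $\lambda\in\Lambda$, are pairwise disjoint. Put $T^B_xf(t)=f(t-x)e^{-2\pi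 i Bx\cdot(t-x)}$. For $X=E$ or $X=E'$ and $\chi\in\mathcal{D}(U)\setminus\{0\}$ let $$X^B_{d,\chi}(\Lambda)=\Big\{c\in\mathbb{C}^\Lambda \;\Big|\; S_\chi(c)=\sum_{\lambda\in\Lambda}c_\lambda T^B_\lambda\chi\in X\Big\},\qquad \|c\|_{X^B_{d,\chi}(\Lambda)}=\|S_\chi(c)\|_X,$$ and similarly with $-B$ in place of $B$. Given an invertible matrix $A_\Lambda$ with $\Lambda=A_\Lambda\mathbb{Z}^n$, a series $\sum_{\lambda\in\Lambda}x_\lambda$ of complex numbers is called Césaro summable to $s$ with respect to $A_\Lambda$ if $$\lim_{N\to\infty}\sum_{m\in\mathbb{Z}^n,\ |m_j|<N}\Big(1-\frac{|m_1|}{N}\Big)\cdots\Big(1-\frac{|m_n|}{N}\Big)x_{A_\Lambda m}=s.$$ Proposition. Let $E$ be a TMIB on $\mathbb{R}^n$ and let $\chi,\chi'\in\mathcal{D}(U)\setminus\{0\}$. For all $c'\in(E')^{-B}_{d,\chi'}(\Lambda)$ and $c\in E^B_{d,\chi}(\Lambda)$ the series $$\langle c',c\rangle=\sum_{\lambda\in\Lambda}c'_\lambda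 c_\lambda$$ is Césaro summable in $\mathbb{C}$ with respect to every invertible $A_\Lambda$ with $\Lambda=A_\Lambda\mathbb{Z}^n$, with a sum $\langle c',c\rangle$ that does not depend on $A_\Lambda$, and the map $c'\mapsto\langle c',\cdot\rangle$ is an isomorphism of topological vector spaces from $(E')^{-B}_{d,\chi'}(\Lambda)$ onto the strong dual of $E^B_{d,\chi}(\Lambda)$. -/

import Mathlib

open Filter Topology MeasureTheory Set
open scoped SchwartzMap Distributions ContDiff Pointwise

noncomputable section

/-! ## Translation and modulation of tempered distributions -/

/-- Multiplication by `t ↦ e^{2πi t·ξ}` is given by a function of temperate growth. -/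
theorem hasTemperateGrowth_character {n : ℕ} (ξ : EuclideanSpace ℝ (Fin n)) :
    Function.HasTemperateGrowth (fun t : EuclideanSpace ℝ (Fin n) =>
      Complex.exp (2 * Real.pi * Complex.I * ((inner ℝ t ξ : ℝ) : ℂ))) := by
  have key : Function.HasTemperateGrowth (fun s : ℝ =>
      Complex.exp (2 * Real.pi * Complex.I * (s : ℂ))) := by
    refine ⟨(contDiff_const.mul Complex.ofRealCLM.contDiff).cexp, fun k => ⟨0, (2 * Real.pi) ^ k, fun s => ?_⟩⟩
    have h : ∀ k : ℕ, iteratedDeriv k (fun s : ℝ =>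
        Complex.exp (2 * Real.pi * Complex.I * (s : ℂ))) =
        fun s : ℝ => (2 * Real.pi * Complex.I) ^ k *
          Complex.exp (2 * Real.pi * Complex.I * (s : ℂ)) := by
      intro k
      induction k with
      | zero => simp
      | succ k ih =>
        rw [iteratedDeriv_succ, ih]
        funext s
        have h1 : HasDerivAt (fun s : ℝ => 2 * Real.pi * Complex.I * (s : ℂ))
            (2 * Real.pi * Complex.I) s := by
          simpa using (Complex.ofRealCLM.hasDerivAt (x := s)).const_mul
            (2 * Real.pi * Complex.I : ℂ)
        rw [((h1.cexp).const_mul ((2 * Real.pi * Complex.I : ℂ) ^ k)).deriv]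
        ring
    rw [norm_iteratedFDeriv_eq_norm_iteratedDeriv, h]
    have : ‖Complex.exp (2 * Real.pi * Complex.I * (s : ℂ))‖ = 1 := by
      rw [show (2 * Real.pi * Complex.I * (s : ℂ)) = ((2 * Real.pi * s : ℝ) : ℂ) * Complex.I by
        push_cast; ring]
      exact Complex.norm_exp_ofReal_mul_I _
    simp [this, abs_of_pos Real.pi_pos]
  exact key.comp (Function.hasTemperateGrowth_inner_left ξ)

/-- Modulation `M_ξ φ(t) = φ(t) e^{2πi t·ξ}` on Schwartz functions. -/
def schwartzModulation {n : ℕ} (ξ : EuclideanSpace ℝ (Fin n)) :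
    𝓢(EuclideanSpace ℝ (Fin n), ℂ) →L[ℂ] 𝓢(EuclideanSpace ℝ (Fin n), ℂ) :=
  SchwartzMap.smulLeftCLM ℂ fun t =>
    Complex.exp (2 * Real.pi * Complex.I * ((inner ℝ t ξ : ℝ) : ℂ))

theorem schwartzModulation_apply {n : ℕ} (ξ t : EuclideanSpace ℝ (Fin n))
    (φ : 𝓢(EuclideanSpace ℝ (Fin n), ℂ)) :
    schwartzModulation ξ φ t =
      Complex.exp (2 * Real.pi * Complex.I * ((inner ℝ t ξ : ℝ) : ℂ)) * φ t := by
  simp [schwartzModulation, SchwartzMap.smulLeftCLM_apply_apply (hasTemperateGrowth_character ξ)]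

/-- The translate `T_x f` of a tempered distribution (formally `f(t - x)`):
`⟨T_x f, φ⟩ = ⟨f, φ(· + x)⟩`. -/
def distTranslation {n : ℕ} (x : EuclideanSpace ℝ (Fin n))
    (f : StrongDual ℂ 𝓢(EuclideanSpace ℝ (Fin n), ℂ)) :
    StrongDual ℂ 𝓢(EuclideanSpace ℝ (Fin n), ℂ) :=
  f.comp (SchwartzMap.compSubConstCLM ℂ (-x))

/-- The modulation `M_ξ f` of a tempered distribution: `⟨M_ξ f, φ⟩ = ⟨f, M_ξ φ⟩`. -/
def distModulation {n : ℕ} (ξ : EuclideanSpace ℝ (Fin n))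
    (f : StrongDual ℂ 𝓢(EuclideanSpace ℝ (Fin n), ℂ)) :
    StrongDual ℂ 𝓢(EuclideanSpace ℝ (Fin n), ℂ) :=
  f.comp (schwartzModulation ξ)

/-! ## Translation-modulation invariant Banach spaces of distributions -/

/-- A continuous linear inclusion of a normed space `X` into the space `𝓢'(ℝⁿ)` of tempered
distributions (the strong dual of `𝓢(ℝⁿ)`). -/
structure TemperedInclusion (n : ℕ) (X : Type*) [NormedAddCommGroup X] [NormedSpace ℂ X] where
  toDist : X →L[ℂ] StrongDual ℂ 𝓢(EuclideanSpace ℝ (Fin n), ℂ)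
  injective : Function.Injective toDist

/-- The structure of a translation-modulation invariant Banach space of distributions (TMIB) on
the Banach space `E`: dense continuous inclusions `𝓢(ℝⁿ) ↪ E ↪ 𝓢'(ℝⁿ)` whose composition is the
canonical inclusion, invariance under all translations and modulations, and polynomial bounds
for the operator norms of `T_x` and `M_{-ξ}` on `E`. (Density of `E` in `𝓢'(ℝⁿ)` is automatic,
because `𝓢(ℝⁿ)` is dense in `𝓢'(ℝⁿ)`.) -/
structure TMIB (n : ℕ) (E : Type*) [NormedAddCommGroup E] [NormedSpace ℂ E] [CompleteSpace E]
    extends TemperedInclusion n E where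
  ofSchwartz : 𝓢(EuclideanSpace ℝ (Fin n), ℂ) →L[ℂ] E
  denseRange_ofSchwartz : DenseRange ofSchwartz
  toDist_ofSchwartz : ∀ φ ψ : 𝓢(EuclideanSpace ℝ (Fin n), ℂ),
    toDist (ofSchwartz φ) ψ = ∫ t, φ t * ψ t
  translation_mem : ∀ (x : EuclideanSpace ℝ (Fin n)) (e : E),
    ∃ e' : E, toDist e' = distTranslation x (toDist e)
  modulation_mem : ∀ (ξ : EuclideanSpace ℝ (Fin n)) (e : E),
    ∃ e' : E, toDist e' = distModulation ξ (toDist e)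
  translation_bound : ∃ C τ : ℝ, 0 < C ∧ 0 < τ ∧
    ∀ (x : EuclideanSpace ℝ (Fin n)) (e e' : E), toDist e' = distTranslation x (toDist e) →
      ‖e'‖ ≤ C * (1 + ‖x‖) ^ τ * ‖e‖
  modulation_bound : ∃ C τ : ℝ, 0 < C ∧ 0 < τ ∧
    ∀ (ξ : EuclideanSpace ℝ (Fin n)) (e e' : E), toDist e' = distModulation (-ξ) (toDist e) →
      ‖e'‖ ≤ C * (1 + ‖ξ‖) ^ τ * ‖e‖

/-- The strong dual `E'` of a TMIB `E`, included in `𝓢'(ℝⁿ)` by restricting functionals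
to `𝓢(ℝⁿ)`. -/
def TMIB.dual {n : ℕ} {E : Type*} [NormedAddCommGroup E] [NormedSpace ℂ E] [CompleteSpace E]
    (h : TMIB n E) : TemperedInclusion n (StrongDual ℂ E) where
  toDist := ContinuousLinearMap.precomp ℂ h.ofSchwartz
  injective := by
    intro f g hfg
    have h1 : f ∘ h.ofSchwartz = g ∘ h.ofSchwartz := by
      funext φ
      exact DFunLike.congr_fun hfg φ
    exact DFunLike.coe_injective
      (h.denseRange_ofSchwartz.equalizer f.continuous g.continuous h1)

theorem TMIB.dual_toDist_apply {n : ℕ} {E : Type*} [NormedAddCommGroup E] [NormedSpace ℂ E]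
    [CompleteSpace E] (h : TMIB n E) (e' : StrongDual ℂ E)
    (φ : 𝓢(EuclideanSpace ℝ (Fin n), ℂ)) : h.dual.toDist e' φ = e' (h.ofSchwartz φ) := rfl

/-! ## Discrete spaces -/

/-- The twisted translation `T^B_x f(t) = f(t - x) e^{-2πi Bx·(t - x)}`. -/
def twistedTranslation {n : ℕ} (B : Matrix (Fin n) (Fin n) ℝ) (x : EuclideanSpace ℝ (Fin n))
    (f : EuclideanSpace ℝ (Fin n) → ℂ) (t : EuclideanSpace ℝ (Fin n)) : ℂ :=
  f (t - x) *
    Complex.exp (-(2 * Real.pi * Complex.I * ((inner ℝ (B.toEuclideanLin x) (t - x) : ℝ) : ℂ)))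

/-- `S_χ(c) = ∑_{λ ∈ Λ} c_λ T^B_λ χ = f` in `𝓓'(ℝⁿ)`: for every test function `φ` one has
`∑_{λ ∈ Λ} c_λ ∫ T^B_λ χ(t) φ(t) dt = ⟨f, φ⟩`. (As `χ` and `φ` have compact support, only finitely
many terms of this sum are non-zero.) -/
def IsSynthesis {n : ℕ} (B : Matrix (Fin n) (Fin n) ℝ)
    (Λ : Submodule ℤ (EuclideanSpace ℝ (Fin n))) (χ : EuclideanSpace ℝ (Fin n) → ℂ)
    (c : Λ → ℂ) (f : StrongDual ℂ 𝓢(EuclideanSpace ℝ (Fin n), ℂ)) : Prop :=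
  ∀ φ : 𝓢(EuclideanSpace ℝ (Fin n), ℂ), HasCompactSupport φ →
    HasSum (fun l : Λ => c l * ∫ t, twistedTranslation B (l : EuclideanSpace ℝ (Fin n)) χ t * φ t)
      (f φ)

/-- Compactly supported smooth functions are dense in `𝓢(ℝⁿ)`, so a tempered distribution that
vanishes on them is zero. -/
theorem tempered_eq_zero_of_compactSupport {n : ℕ}
    (f : StrongDual ℂ 𝓢(EuclideanSpace ℝ (Fin n), ℂ))
    (hf : ∀ φ : 𝓢(EuclideanSpace ℝ (Fin n), ℂ), HasCompactSupport φ → f φ = 0) : f = 0 := by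
  ext ψ
  obtain ⟨b, hbr⟩ : ∃ b : ContDiffBump (0 : EuclideanSpace ℝ (Fin n)), b.rIn = 1 :=
    ⟨⟨1, 2, by norm_num, by norm_num⟩, rfl⟩
  -- `h` vanishes on the unit ball, and its derivatives of every order are bounded
  set h : EuclideanSpace ℝ (Fin n) → ℂ := fun x => 1 - ((b x : ℝ) : ℂ) with hh
  have hb0 : ContDiff ℝ ∞ (fun x => ((b x : ℝ) : ℂ)) :=
    Complex.ofRealCLM.contDiff.comp b.contDiff
  have hbc : HasCompactSupport (fun x => ((b x : ℝ) : ℂ)) :=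
    b.hasCompactSupport.comp_left (g := fun r : ℝ => (r : ℂ)) (by simp)
  have hs : ContDiff ℝ ∞ h := contDiff_const.sub hb0
  have hM : ∀ q : ℕ, ∃ M : ℝ, 0 ≤ M ∧ ∀ x, ‖iteratedFDeriv ℝ q h x‖ ≤ M := by
    intro q
    obtain ⟨C, hC⟩ := (hb0.continuous_iteratedFDeriv (m := q)
      (mod_cast le_top)).bounded_above_of_compact_support (hbc.iteratedFDeriv q)
    refine ⟨1 + C, by linarith [(norm_nonneg _).trans (hC 0)], fun x => ?_⟩
    have : iteratedFDeriv ℝ q h x = iteratedFDeriv ℝ q (fun _ => (1 : ℂ)) x -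
        iteratedFDeriv ℝ q (fun x => ((b x : ℝ) : ℂ)) x :=
      iteratedFDeriv_sub_apply contDiff_const.contDiffAt
        (hb0.of_le (mod_cast le_top)).contDiffAt
    rw [this]
    refine (norm_sub_le _ _).trans (add_le_add ?_ (hC x))
    rcases Nat.eq_zero_or_pos q with rfl | hq
    · simp
    · simp [iteratedFDeriv_const_of_ne hq.ne']
  choose M hM0 hM using hM
  have hcpt : ∀ k : ℕ, HasCompactSupport
      fun x => ((b (((k : ℝ) + 1)⁻¹ • x) : ℝ) : ℂ) * ψ x := fun k =>
    (hbc.comp_smul (c := ((k : ℝ) + 1)⁻¹) (by positivity)).mul_right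
  have hsm : ∀ k : ℕ, ContDiff ℝ ∞
      fun x => ((b (((k : ℝ) + 1)⁻¹ • x) : ℝ) : ℂ) * ψ x := fun k =>
    (hb0.comp (contDiff_const_smul _)).mul (ψ.smooth ⊤)
  set u : ℕ → 𝓢(EuclideanSpace ℝ (Fin n), ℂ) := fun k => (hcpt k).toSchwartzMap (hsm k) with hu
  have hlim : Tendsto u atTop (𝓝 ψ) := by
    rw [(schwartz_withSeminorms ℂ (EuclideanSpace ℝ (Fin n)) ℂ).tendsto_nhds]
    rintro ⟨p, q⟩ ε hε
    set C : ℝ := ∑ j ∈ Finset.range (q + 1),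
      (q.choose j : ℝ) * M j * SchwartzMap.seminorm ℂ (p + 1) (q - j) ψ with hC
    have hC0 : 0 ≤ C := Finset.sum_nonneg fun j _ =>
      mul_nonneg (mul_nonneg (by positivity) (hM0 j)) (apply_nonneg _ _)
    have hbound : ∀ k : ℕ, SchwartzMap.seminorm ℂ p q (u k - ψ) ≤ C / ((k : ℝ) + 1) := by
      intro k
      have hk : (0 : ℝ) < (k : ℝ) + 1 := by positivity
      refine SchwartzMap.seminorm_le_bound ℂ p q _ (by positivity) fun x => ?_
      have hfun : ((ψ - u k : 𝓢(EuclideanSpace ℝ (Fin n), ℂ)) :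
          EuclideanSpace ℝ (Fin n) → ℂ) = fun x => h (((k : ℝ) + 1)⁻¹ • x) * ψ x := by
        funext x
        simp [hu, hh, sub_mul]
      have hneg : ‖iteratedFDeriv ℝ q (u k - ψ : 𝓢(EuclideanSpace ℝ (Fin n), ℂ)) x‖ =
          ‖iteratedFDeriv ℝ q (fun x => h (((k : ℝ) + 1)⁻¹ • x) * ψ x) x‖ := by
        rw [← hfun, ← neg_sub ψ (u k)]
        have : ((-(ψ - u k) : 𝓢(EuclideanSpace ℝ (Fin n), ℂ)) :
          EuclideanSpace ℝ (Fin n) → ℂ) = -(ψ - u k : 𝓢(EuclideanSpace ℝ (Fin n), ℂ)) := rfl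
        rw [this, iteratedFDeriv_neg_apply, norm_neg]
      rw [hneg]
      rcases lt_or_ge ‖x‖ ((k : ℝ) + 1) with hx | hx
      · have hev : (fun x => h (((k : ℝ) + 1)⁻¹ • x) * ψ x) =ᶠ[𝓝 x] fun _ => 0 := by
          filter_upwards [(isOpen_lt continuous_norm continuous_const).mem_nhds hx] with y hy
          have hy1 : b (((k : ℝ) + 1)⁻¹ • y) = 1 := by
            apply b.one_of_mem_closedBall
            have : ‖y‖ < (k : ℝ) + 1 := hy
            rw [mem_closedBall_zero_iff, norm_smul, norm_inv, Real.norm_of_nonneg hk.le, hbr,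
              inv_mul_le_iff₀ hk]
            linarith
          simp [hh, hy1]
        rw [(Filter.EventuallyEq.iteratedFDeriv ℝ hev q).eq_of_nhds]
        simp only [iteratedFDeriv_fun_zero, Pi.zero_apply, norm_zero, mul_zero]
        positivity
      · have h1 := norm_iteratedFDeriv_mul_le (𝕜 := ℝ) (n := q) (N := ∞)
          (hs.comp (contDiff_const_smul (((k : ℝ) + 1)⁻¹))) (ψ.smooth ⊤) x (mod_cast le_top)
        have h2 : ∀ j, ‖iteratedFDeriv ℝ j (h ∘ fun x => ((k : ℝ) + 1)⁻¹ • x) x‖ ≤ M j := by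
          intro j
          have := congrFun (iteratedFDeriv_comp_const_smul (𝕜 := ℝ) (i := j) (((k : ℝ) + 1)⁻¹)
            (hs.of_le (mod_cast le_top))) x
          change ‖iteratedFDeriv ℝ j (fun z => h (((k : ℝ) + 1)⁻¹ • z)) x‖ ≤ M j
          rw [this, norm_smul]
          have h3 : ‖(((k : ℝ) + 1)⁻¹) ^ j‖ ≤ 1 := by
            rw [norm_pow, norm_inv, Real.norm_of_nonneg hk.le]
            exact pow_le_one₀ (by positivity) (inv_le_one_of_one_le₀ (by linarith))
          calc _ ≤ 1 * M j := mul_le_mul h3 (hM j _) (norm_nonneg _) zero_le_one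
            _ = M j := one_mul _
        rw [le_div_iff₀ hk]
        calc _ ≤ ‖x‖ ^ p * (∑ j ∈ Finset.range (q + 1),
              (q.choose j : ℝ) * M j * ‖iteratedFDeriv ℝ (q - j) ψ x‖) * ‖x‖ := by
              refine mul_le_mul (mul_le_mul_of_nonneg_left ?_ (pow_nonneg (norm_nonneg x) p)) hx
                hk.le (mul_nonneg (pow_nonneg (norm_nonneg x) p) (Finset.sum_nonneg fun j _ =>
                  mul_nonneg (mul_nonneg (by positivity) (hM0 j)) (norm_nonneg _)))
              refine h1.trans (Finset.sum_le_sum fun j _ => ?_)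
              exact mul_le_mul_of_nonneg_right
                (mul_le_mul_of_nonneg_left (h2 j) (by positivity)) (norm_nonneg _)
          _ = ∑ j ∈ Finset.range (q + 1),
              (q.choose j : ℝ) * M j * (‖x‖ ^ (p + 1) * ‖iteratedFDeriv ℝ (q - j) ψ x‖) := by
              rw [Finset.mul_sum, Finset.sum_mul]
              refine Finset.sum_congr rfl fun j _ => ?_
              ring
          _ ≤ C := by
              refine Finset.sum_le_sum fun j _ => ?_
              exact mul_le_mul_of_nonneg_left (SchwartzMap.le_seminorm ℂ _ _ ψ x)
                (mul_nonneg (by positivity) (hM0 j))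
    have ht : Tendsto (fun k : ℕ => C / ((k : ℝ) + 1)) atTop (𝓝 0) := by
      simpa [div_eq_mul_inv] using (tendsto_one_div_add_atTop_nhds_zero_nat (𝕜 := ℝ)).const_mul C
    filter_upwards [ht.eventually (gt_mem_nhds hε)] with k hk
    exact (hbound k).trans_lt hk
  have h1 : Tendsto (fun k => f (u k)) atTop (𝓝 (f ψ)) := (f.continuous.tendsto ψ).comp hlim
  have h2 : (fun k => f (u k)) = fun _ => 0 := funext fun k => hf _ (hcpt k)
  rw [h2] at h1
  simpa using (tendsto_nhds_unique h1 tendsto_const_nhds)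

theorem IsSynthesis.unique {n : ℕ} {X : Type*} [NormedAddCommGroup X] [NormedSpace ℂ X]
    {i : TemperedInclusion n X} {B : Matrix (Fin n) (Fin n) ℝ}
    {Λ : Submodule ℤ (EuclideanSpace ℝ (Fin n))} {χ : EuclideanSpace ℝ (Fin n) → ℂ} {c : Λ → ℂ}
    {e e' : X} (h : IsSynthesis B Λ χ c (i.toDist e)) (h' : IsSynthesis B Λ χ c (i.toDist e')) :
    e = e' := by
  apply i.injective
  rw [← sub_eq_zero]
  refine tempered_eq_zero_of_compactSupport _ fun φ hφ => ?_
  simpa [sub_eq_zero] using (h φ hφ).unique (h' φ hφ)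

/-- The underlying vector space of `X^B_d(Λ)`: sequences `c ∈ ℂ^Λ` with `S_χ(c) ∈ X`. -/
def discreteSubmodule {n : ℕ} {X : Type*} [NormedAddCommGroup X] [NormedSpace ℂ X]
    (i : TemperedInclusion n X) (B : Matrix (Fin n) (Fin n) ℝ)
    (Λ : Submodule ℤ (EuclideanSpace ℝ (Fin n))) (χ : EuclideanSpace ℝ (Fin n) → ℂ) :
    Submodule ℂ (Λ → ℂ) where
  carrier := {c | ∃ e : X, IsSynthesis B Λ χ c (i.toDist e)}
  zero_mem' := ⟨0, fun φ _ => by simp⟩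
  add_mem' := by
    rintro c d ⟨e, he⟩ ⟨e', he'⟩
    exact ⟨e + e', fun φ hφ => by simpa [add_mul] using (he φ hφ).add (he' φ hφ)⟩
  smul_mem' := by
    rintro a c ⟨e, he⟩
    exact ⟨a • e, fun φ hφ => by simpa [mul_assoc] using (he φ hφ).mul_left a⟩

/-- The discrete space `X^B_d(Λ) = X^B_{d,χ}(Λ)` associated with `X ⊆ 𝓢'(ℝⁿ)`. -/
def DiscreteSpace {n : ℕ} {X : Type*} [NormedAddCommGroup X] [NormedSpace ℂ X]
    (i : TemperedInclusion n X) (B : Matrix (Fin n) (Fin n) ℝ)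
    (Λ : Submodule ℤ (EuclideanSpace ℝ (Fin n))) (χ : EuclideanSpace ℝ (Fin n) → ℂ) : Type :=
  discreteSubmodule i B Λ χ

namespace DiscreteSpace

variable {n : ℕ} {X : Type*} [NormedAddCommGroup X] [NormedSpace ℂ X]
  {i : TemperedInclusion n X} {B : Matrix (Fin n) (Fin n) ℝ}
  {Λ : Submodule ℤ (EuclideanSpace ℝ (Fin n))} {χ : EuclideanSpace ℝ (Fin n) → ℂ}

instance : AddCommGroup (DiscreteSpace i B Λ χ) :=
  inferInstanceAs (AddCommGroup (discreteSubmodule i B Λ χ))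

instance : Module ℂ (DiscreteSpace i B Λ χ) :=
  inferInstanceAs (Module ℂ (discreteSubmodule i B Λ χ))

/-- The entries `c_λ` of `c ∈ X^B_d(Λ)`. -/
instance : CoeFun (DiscreteSpace i B Λ χ) fun _ => Λ → ℂ where
  coe c := c.1

@[simp] theorem add_apply (c d : DiscreteSpace i B Λ χ) (l : Λ) : (c + d) l = c l + d l := rfl

@[simp] theorem smul_apply (a : ℂ) (c : DiscreteSpace i B Λ χ) (l : Λ) :
    (a • c) l = a * c l := rfl

variable (i B Λ χ) in
/-- The map `c ↦ S_χ(c)` from `X^B_d(Λ)` to `X`. -/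
def synthesis : DiscreteSpace i B Λ χ →ₗ[ℂ] X where
  toFun c := c.2.choose
  map_add' c d := IsSynthesis.unique (c + d).2.choose_spec fun φ hφ => by
    simpa [add_mul] using (c.2.choose_spec φ hφ).add (d.2.choose_spec φ hφ)
  map_smul' a c := IsSynthesis.unique (a • c).2.choose_spec fun φ hφ => by
    simpa [mul_assoc] using (c.2.choose_spec φ hφ).mul_left a

theorem isSynthesis_synthesis (c : DiscreteSpace i B Λ χ) :
    IsSynthesis B Λ χ c (i.toDist (synthesis i B Λ χ c)) :=
  c.2.choose_spec

/-- The norm `‖c‖ = ‖S_χ(c)‖_X`. (It is definite under the hypotheses of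
`eq_zero_of_norm_eq_zero` below.) -/
instance : SeminormedAddCommGroup (DiscreteSpace i B Λ χ) :=
  SeminormedAddCommGroup.induced (DiscreteSpace i B Λ χ) X (synthesis i B Λ χ)

instance : NormedSpace ℂ (DiscreteSpace i B Λ χ) :=
  NormedSpace.induced ℂ (DiscreteSpace i B Λ χ) X (synthesis i B Λ χ)

theorem norm_def (c : DiscreteSpace i B Λ χ) : ‖c‖ = ‖synthesis i B Λ χ c‖ := rfl

/-- `c ↦ S_χ(c)` is injective, that is, the norm of `X^B_d(Λ)` is definite, if the translates
`λ + supp χ` are pairwise disjoint and `χ ≠ 0`. -/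
theorem eq_zero_of_norm_eq_zero (U : TopologicalSpace.Opens (EuclideanSpace ℝ (Fin n)))
    (hUd : Pairwise fun l m : Λ =>
      Disjoint ((l : EuclideanSpace ℝ (Fin n)) +ᵥ (U : Set (EuclideanSpace ℝ (Fin n))))
        ((m : EuclideanSpace ℝ (Fin n)) +ᵥ (U : Set (EuclideanSpace ℝ (Fin n)))))
    (χ : 𝓓(U, ℂ)) (hχ : χ ≠ 0) (c : DiscreteSpace i B Λ χ) (hc : ‖c‖ = 0) : c = 0 := by
  have hS : synthesis i B Λ χ c = 0 := by rwa [norm_def, norm_eq_zero] at hc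
  have hsyn := isSynthesis_synthesis c
  rw [hS, map_zero] at hsyn
  apply Subtype.ext
  funext l
  change c l = 0
  set g : Λ → EuclideanSpace ℝ (Fin n) → ℂ := fun m =>
    twistedTranslation B (m : EuclideanSpace ℝ (Fin n)) χ with hg
  have hsub : ∀ m : Λ, ∀ t, g m t ≠ 0 →
      t ∈ (m : EuclideanSpace ℝ (Fin n)) +ᵥ (U : Set (EuclideanSpace ℝ (Fin n))) := by
    intro m t ht
    have h1 : χ (t - m) ≠ 0 := fun h0 => ht (by simp [hg, twistedTranslation, h0])
    rw [Set.mem_vadd_set_iff_neg_vadd_mem, vadd_eq_add, neg_add_eq_sub]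
    exact χ.tsupport_subset (subset_tsupport _ h1)
  have hshift : ContDiff ℝ ∞ fun t : EuclideanSpace ℝ (Fin n) => t - (l : EuclideanSpace ℝ (Fin n)) :=
    contDiff_id.sub contDiff_const
  have hexp : ContDiff ℝ ∞ fun t : EuclideanSpace ℝ (Fin n) =>
      Complex.exp (-(2 * Real.pi * Complex.I *
        ((inner ℝ (B.toEuclideanLin (l : EuclideanSpace ℝ (Fin n)))
          (t - (l : EuclideanSpace ℝ (Fin n))) : ℝ) : ℂ))) :=
    (contDiff_const.mul (Complex.ofRealCLM.contDiff.comp (contDiff_const.inner ℝ hshift))).neg.cexp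
  have hgs : ContDiff ℝ ∞ (g l) := (χ.contDiff.comp hshift).mul hexp
  have hgc : HasCompactSupport (g l) :=
    (χ.hasCompactSupport.comp_homeomorph
      (Homeomorph.subRight (l : EuclideanSpace ℝ (Fin n)))).mul_right
  have hcs : ContDiff ℝ ∞ fun t => (starRingEnd ℂ) (g l t) :=
    Complex.conjCLE.contDiff.comp hgs
  have hcc : HasCompactSupport fun t => (starRingEnd ℂ) (g l t) :=
    hgc.comp_left (g := starRingEnd ℂ) (map_zero _)
  have h1 := hsyn (hcc.toSchwartzMap hcs) hcc
  have h2 := hasSum_single (f := fun m : Λ => c m * ∫ t, g m t * (starRingEnd ℂ) (g l t)) l (by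
    intro m hm
    have : (fun t => g m t * (starRingEnd ℂ) (g l t)) = fun _ => 0 := by
      funext t
      by_contra hne
      rw [← ne_eq, mul_ne_zero_iff, map_ne_zero] at hne
      exact Set.disjoint_left.1 (hUd hm) (hsub m t hne.1) (hsub l t hne.2)
    simp [this])
  have h3 : c l * ∫ t, g l t * (starRingEnd ℂ) (g l t) = 0 := by
    simpa using h2.unique h1
  refine (mul_eq_zero.1 h3).resolve_right fun h4 => hχ ?_
  have h5 : ∫ t, ‖g l t‖ ^ 2 = 0 := by
    have : (fun t => g l t * (starRingEnd ℂ) (g l t)) = fun t => ((‖g l t‖ ^ 2 : ℝ) : ℂ) := by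
      funext t
      rw [Complex.mul_conj, Complex.normSq_eq_norm_sq]
    rw [this, integral_complex_ofReal] at h4
    exact_mod_cast h4
  have hcont : Continuous fun t => ‖g l t‖ ^ 2 := hgs.continuous.norm.pow 2
  have hsc : HasCompactSupport fun t => ‖g l t‖ ^ 2 :=
    hgc.comp_left (g := fun z : ℂ => ‖z‖ ^ 2) (by simp)
  have h6 : ∀ t, ‖g l t‖ ^ 2 = 0 := by
    by_contra! hne
    obtain ⟨t, ht⟩ := hne
    exact (hcont.integral_pos_of_hasCompactSupport_nonneg_nonzero hsc
      (fun t => by positivity) ht).ne' h5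
  ext t
  have h7 := h6 (t + l)
  simpa [hg, twistedTranslation] using h7

end DiscreteSpace

/-- Césaro summability of `∑_{λ ∈ Λ} x_λ` to `s` with respect to the basis `b` of the lattice `Λ`
(the basis vectors are the columns of the matrix `A_Λ`, so that `A_Λ m = ∑ j, m_j b_j`). -/
def HasCesaroSum {n : ℕ} {Λ : Submodule ℤ (EuclideanSpace ℝ (Fin n))}
    (b : Module.Basis (Fin n) ℤ Λ) (x : Λ → ℂ) (s : ℂ) : Prop :=
  Tendsto (fun N : ℕ =>
      ∑ m ∈ Fintype.piFinset fun _ : Fin n => Finset.Ioo (-(N : ℤ)) (N : ℤ),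
        ((∏ j, (1 - |(m j : ℝ)| / (N : ℝ)) : ℝ) : ℂ) * x (∑ j, m j • b j))
    atTop (𝓝 s)

end

open Filter Topology MeasureTheory Set
open scoped SchwartzMap Distributions ContDiff Pointwise

noncomputable section

/-! The engine is the family of operators A_ξ f = ∑_λ e^{-2πiλ·ξ} ⟨f, T^{-B}_λ ψ⟩ T^B_λ χ on E, with
χ and ψ smooth of compact support. Since the two twists have opposite signs, their phases at the
points t and t - z combine to e^{-2πiλ·Bᵀz}, a character in λ. Poisson summation over Λ therefore
applies to the kernel and gives A_ξ f = κ ∑_k ∫ V(z, η_k(z)) M_{η_k(z)} T_z f dz for test functions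
f, where η_k(z) = -(μ_k + Bᵀz + ξ), μ_k runs over the dual lattice and V is the cross-ambiguity
function of χ and ψ. V vanishes for large z and decays rapidly in η, whereas M_η T_z grows only
polynomially on E. So A_ξ is bounded on test functions, uniformly for bounded ξ
(`TMIB.exists_norm_sum_le`).

The Césaro weights are convex combinations of characters of the lattice (Fejér), so the Césaro means
of A_0 are averages of the A_ξ and uniformly bounded. On the dense space of test functions they are
eventually means of finite sums, hence they converge strongly on E (`TMIB.exists_frameOp`).

The duality follows by choosing windows. If ψ is supported in U and ∫ χψ = 1, then A_0 fixes S_χ(c),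
so the Césaro means of c converge to c and every continuous functional is the Césaro sum of its
values on the unit sequences e_λ (`TMIB.hasCesaroSum_dual`). With χ' as analysis window one gets a
bounded map Q from E to E^B_d, and for a functional L on E^B_d the element L ∘ Q of E' is the
synthesis of (L(e_λ))_λ (`TMIB.isSynthesis_comp_analysis`); this yields surjectivity and the lower
norm bound. Conversely, S_{χ'}(c') becomes a functional on E^B_d after composition with S_χ and an
operator that replaces χ by a dual window of χ' (`TMIB.exists_pairing`). -/

/-- The character `e(s) = e^{2πis}` of the real line. -/
def expChar (s : ℝ) : ℂ := Complex.exp (2 * Real.pi * Complex.I * (s : ℂ))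

theorem expChar_add (s t : ℝ) : expChar (s + t) = expChar s * expChar t := by
  rw [expChar, expChar, expChar, ← Complex.exp_add]
  push_cast
  ring_nf

@[simp] theorem expChar_zero : expChar 0 = 1 := by simp [expChar]

@[simp] theorem norm_expChar (s : ℝ) : ‖expChar s‖ = 1 := by
  rw [expChar, show (2 * Real.pi * Complex.I * (s : ℂ)) = ((2 * Real.pi * s : ℝ) : ℂ) * Complex.I by
    push_cast; ring]
  exact Complex.norm_exp_ofReal_mul_I _

theorem expChar_neg (s : ℝ) : expChar (-s) = Complex.exp (-(2 * Real.pi * Complex.I * (s : ℂ))) := by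
  rw [expChar]
  push_cast
  ring_nf

theorem expChar_sum {ι : Type*} (s : Finset ι) (f : ι → ℝ) :
    expChar (∑ i ∈ s, f i) = ∏ i ∈ s, expChar (f i) := by
  simp only [expChar]
  rw [← Complex.exp_sum]; push_cast; rw [Finset.mul_sum]

theorem expChar_int (m : ℤ) : expChar m = 1 := by
  rw [expChar, Complex.exp_eq_one_iff]
  exact ⟨m, by push_cast; ring⟩

theorem expChar_conj (s : ℝ) : (starRingEnd ℂ) (expChar s) = expChar (-s) := by
  rw [expChar, expChar, ← Complex.exp_conj]; simp [Complex.conj_ofNat]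

theorem contDiff_expChar : ContDiff ℝ ∞ expChar :=
  (contDiff_const.mul Complex.ofRealCLM.contDiff).cexp

@[fun_prop] theorem continuous_expChar : Continuous expChar := contDiff_expChar.continuous

/-! ### Poisson summation over the integer lattice, for compactly supported functions. -/

section Poisson

variable {ι : Type*} [Fintype ι]

/-- The `ℤ^ι`-periodization of a function on `ℝ^ι`. -/
def periodization {ι : Type*} (f : (ι → ℝ) → ℂ) (x : ι → ℝ) : ℂ :=
  ∑' m : ι → ℤ, f (fun i => x i + m i)

theorem periodization_add_int {ι : Type*} (f : (ι → ℝ) → ℂ) (x : ι → ℝ) (k : ι → ℤ) :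
    periodization f (fun i => x i + k i) = periodization f x := by
  rw [periodization, periodization, ← (Equiv.addLeft k).tsum_eq (fun m : ι → ℤ => f fun i => x i + m i)]
  refine tsum_congr fun m => ?_
  congr 1
  ext i
  simp [add_assoc]

/-- Makes the periodization a finite sum with one index set on each ball, which is what gives
continuity and termwise integration below. -/
theorem exists_finset_periodization {f : (ι → ℝ) → ℂ} (hf : HasCompactSupport f) (R : ℝ) :
    ∃ s : Finset (ι → ℤ), ∀ x : ι → ℝ, ‖x‖ ≤ R → ∀ m ∉ s, f (fun i => x i + m i) = 0 := by
  obtain ⟨R', hR'⟩ := hf.isCompact.isBounded.exists_norm_le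
  classical
  refine ⟨Fintype.piFinset fun _ => Finset.Icc (-⌈R + R'⌉) ⌈R + R'⌉, fun x hx m hm => ?_⟩
  by_contra h
  apply hm
  have h1 := hR' _ (subset_tsupport _ h)
  rw [Fintype.mem_piFinset]
  intro i
  have h2 : |x i + m i| ≤ R' := (norm_le_pi_norm (fun i => x i + (m i : ℝ)) i).trans h1
  have h3 : |x i| ≤ R := (norm_le_pi_norm x i).trans hx
  have h4 : |(m i : ℝ)| ≤ R + R' := by
    calc |(m i : ℝ)| = |(x i + m i) - x i| := by ring_nf
      _ ≤ |x i + m i| + |x i| := abs_sub _ _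
      _ ≤ R + R' := by linarith
  rw [Finset.mem_Icc]
  have h5 := abs_le.1 (h4.trans (Int.le_ceil _))
  exact ⟨by exact_mod_cast h5.1, by exact_mod_cast h5.2⟩

theorem continuous_periodization {f : (ι → ℝ) → ℂ} (hc : Continuous f) (hf : HasCompactSupport f) :
    Continuous (periodization f) := by
  rw [continuous_iff_continuousAt]
  intro x
  obtain ⟨s, hs⟩ := exists_finset_periodization hf (‖x‖ + 1)
  have h : periodization f =ᶠ[𝓝 x] fun y => ∑ m ∈ s, f (fun i => y i + m i) := by
    filter_upwards [(isOpen_lt continuous_norm continuous_const).mem_nhds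
      (show ‖x‖ < ‖x‖ + 1 by linarith)] with y hy
    exact tsum_eq_sum fun m hm => hs y (le_of_lt hy) m hm
  refine ContinuousAt.congr ?_ h.symm
  exact Continuous.continuousAt (by fun_prop)

theorem exists_coe_equivIoc_eq (x : ℝ) :
    ∃ k : ℤ, (AddCircle.equivIoc (1 : ℝ) 0 (x : UnitAddCircle)).1 = x + k := by
  have h : ((AddCircle.equivIoc (1 : ℝ) 0 (x : UnitAddCircle)).1 : UnitAddCircle) = x :=
    (AddCircle.equivIoc (1 : ℝ) 0).symm_apply_apply _
  obtain ⟨k, hk⟩ := AddSubgroup.mem_zmultiples_iff.1 (QuotientAddGroup.eq.1 h.symm)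
  exact ⟨k, by simp at hk; linarith⟩

/-- The periodization as a function on the torus. -/
def torusPeriodization {f : (ι → ℝ) → ℂ} (hc : Continuous f) (hf : HasCompactSupport f) :
    C(UnitAddTorus ι, ℂ) where
  toFun y := periodization f fun i => (AddCircle.equivIoc (1 : ℝ) 0 (y i)).1
  continuous_toFun := by
    -- The representative in (0, 1] jumps at integers, but the periodization ignores integer shifts;
    -- continuity is therefore tested after pulling back along the quotient map.
    have hq : IsOpenQuotientMap (fun (x : ι → ℝ) (i : ι) => (x i : UnitAddCircle)) :=
      IsOpenQuotientMap.piMap fun _ => QuotientAddGroup.isOpenQuotientMap_mk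
    rw [hq.isQuotientMap.continuous_iff]
    refine (continuous_periodization hc hf).congr fun x => ?_
    choose k hk using fun i => exists_coe_equivIoc_eq (x i)
    simp only [Function.comp, hk]
    exact (periodization_add_int f x k).symm

theorem torusPeriodization_apply {f : (ι → ℝ) → ℂ} (hc : Continuous f) (hf : HasCompactSupport f)
    (x : ι → ℝ) : torusPeriodization hc hf (fun i => (x i : UnitAddCircle)) = periodization f x := by
  choose k hk using fun i => exists_coe_equivIoc_eq (x i)
  simp only [torusPeriodization, ContinuousMap.coe_mk, hk]
  exact periodization_add_int f x k

theorem mFourier_coe (k : ι → ℤ) (x : ι → ℝ) :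
    UnitAddTorus.mFourier k (fun i => (x i : UnitAddCircle)) = expChar (∑ i, (k i : ℝ) * x i) := by
  rw [expChar_sum]
  simp only [UnitAddTorus.mFourier, ContinuousMap.coe_mk]
  refine Finset.prod_congr rfl fun i _ => ?_
  rw [fourier_coe_apply, expChar]
  push_cast
  ring_nf

/-- The half-open cubes m + (0,1]^ι tile the space, and translation moves each of them to the unit
cube. Only the finitely many m in `s` contribute. -/
theorem integral_eq_sum_cube {f : (ι → ℝ) → ℂ} (hc : Continuous f) (hf : HasCompactSupport f)
    {s : Finset (ι → ℤ)} (hs : ∀ x : ι → ℝ, ‖x‖ ≤ 1 → ∀ m ∉ s, f (fun i => x i + m i) = 0) :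
    ∫ x, f x = ∑ m ∈ s, ∫ x in {x : ι → ℝ | ∀ i, x i ∈ Ioc (0 : ℝ) (0 + 1)},
      f (fun i => x i + m i) := by
  set Q : (ι → ℤ) → Set (ι → ℝ) := fun m => {x | ∀ i, x i ∈ Ioc (m i : ℝ) (m i + 1)} with hQ
  have hQm : ∀ m, MeasurableSet (Q m) := fun m => MeasurableSet.univ_pi' fun i => measurableSet_Ioc
  have hQd : Pairwise (Function.onFun Disjoint Q) := by
    intro m k hmk
    rw [Function.onFun, Set.disjoint_left]
    intro x hx hx'
    apply hmk
    ext i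
    have h1 := hx i
    have h2 := hx' i
    have h3 : (m i : ℝ) < k i + 1 := h1.1.trans_le h2.2
    have h4 : (k i : ℝ) < m i + 1 := h2.1.trans_le h1.2
    have h3 : m i < k i + 1 := by exact_mod_cast h3
    have h4 : k i < m i + 1 := by exact_mod_cast h4
    omega
  have hQu : ⋃ m, Q m = univ := by
    refine eq_univ_of_forall fun x => mem_iUnion.2 ⟨fun i => ⌈x i⌉ - 1, fun i => ?_⟩
    push_cast
    exact ⟨by linarith [Int.ceil_lt_add_one (x i)], by linarith [Int.le_ceil (x i)]⟩
  have hint : Integrable f := hc.integrable_of_hasCompactSupport hf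
  have h1 := hasSum_integral_iUnion (f := f) (μ := volume) hQm hQd hint.integrableOn
  rw [hQu, setIntegral_univ] at h1
  have h2 : ∀ m : ι → ℤ, ∫ x in Q m, f x =
      ∫ x in {x : ι → ℝ | ∀ i, x i ∈ Ioc (0 : ℝ) (0 + 1)}, f (fun i => x i + m i) := by
    intro m
    have h3 := (measurePreserving_add_right (volume : Measure (ι → ℝ))
      (fun i => (m i : ℝ))).setIntegral_preimage_emb (measurableEmbedding_addRight _) f (Q m)
    rw [← h3]
    congr 2
    ext x
    simp [hQ, add_comm _ (1 : ℝ)]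
  simp only [h2] at h1
  refine h1.unique (hasSum_sum_of_ne_finset_zero fun m hm => ?_)
  refine setIntegral_eq_zero_of_forall_eq_zero fun x hx => hs x ?_ m hm
  refine (pi_norm_le_iff_of_nonneg zero_le_one).2 fun i => ?_
  rw [Real.norm_of_nonneg (hx i).1.le]
  simpa using (hx i).2

/-- Unfolding: the integral over the torus of the periodization against a character is the integral
of `f` over the whole space, since the character does not see integer translations. -/
theorem mFourierCoeff_torusPeriodization {f : (ι → ℝ) → ℂ} (hc : Continuous f)
    (hf : HasCompactSupport f) (k : ι → ℤ) :
    UnitAddTorus.mFourierCoeff (torusPeriodization hc hf) k =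
      ∫ x, expChar (-∑ i, (k i : ℝ) * x i) * f x := by
  obtain ⟨s, hs⟩ := exists_finset_periodization hf 1
  have hc' : Continuous fun x : ι → ℝ => expChar (-∑ i, (k i : ℝ) * x i) * f x := by fun_prop
  rw [UnitAddTorus.mFourierCoeff_eq_integral _ _ 0,
    integral_eq_sum_cube hc' hf.mul_left (s := s) fun x hx m hm => by rw [hs x hx m hm, mul_zero],
    ← integral_finsetSum]
  · simp only [Pi.zero_apply]
    refine setIntegral_congr_fun (MeasurableSet.univ_pi' fun i => measurableSet_Ioc) fun x hx => ?_
    have hx1 : ‖x‖ ≤ 1 := by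
      refine (pi_norm_le_iff_of_nonneg zero_le_one).2 fun i => ?_
      rw [Real.norm_of_nonneg (hx i).1.le]
      simpa using (hx i).2
    rw [torusPeriodization_apply, mFourier_coe, periodization,
      tsum_eq_sum fun m hm => hs x hx1 m hm, smul_eq_mul, Finset.mul_sum]
    refine Finset.sum_congr rfl fun m _ => ?_
    congr 1
    have : -∑ i, (k i : ℝ) * (x i + m i) = ∑ i, ((-k) i : ℤ) * x i + ((-∑ i, k i * m i : ℤ) : ℝ) := by
      push_cast
      simp [mul_add, Finset.sum_add_distrib, add_comm]
    rw [this, expChar_add, expChar_int, mul_one]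
  · intro m _
    have : Continuous fun x : ι → ℝ => expChar (-∑ i, (k i : ℝ) * (x i + m i)) * f (fun i => x i + m i) := by
      fun_prop
    refine (this.integrable_of_hasCompactSupport ?_).integrableOn
    exact (hf.comp_homeomorph (Homeomorph.addRight (fun i => (m i : ℝ)))).mul_left

/-- The Poisson summation formula for continuous functions with compact support. -/
theorem hasSum_poisson_pi {f : (ι → ℝ) → ℂ} (hc : Continuous f) (hf : HasCompactSupport f)
    (h : Summable fun k : ι → ℤ => ∫ x, expChar (-∑ i, (k i : ℝ) * x i) * f x) :
    HasSum (fun k : ι → ℤ => ∫ x, expChar (-∑ i, (k i : ℝ) * x i) * f x)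
      (∑' m : ι → ℤ, f fun i => m i) := by
  -- Absolute summability makes the Fourier series converge pointwise; at the origin all characters
  -- are 1.
  have h1 := UnitAddTorus.hasSum_mFourier_series_apply_of_summable (f := torusPeriodization hc hf)
    (h.congr fun k => (mFourierCoeff_torusPeriodization hc hf k).symm) (fun _ => ((0 : ℝ) : UnitAddCircle))
  rw [torusPeriodization_apply hc hf (fun _ => (0 : ℝ))] at h1
  simp only [mFourier_coe _ (fun _ => (0 : ℝ)), mFourierCoeff_torusPeriodization] at h1
  simpa [periodization] using h1

end Poisson

/-! ### Coordinates, the dual lattice and Poisson summation for a general lattice. -/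

section Lattice

variable {n : ℕ} {Λ : Submodule ℤ (EuclideanSpace ℝ (Fin n))} [DiscreteTopology Λ] [IsZLattice ℝ Λ]

/-- The dual basis of a basis of a lattice, as vectors of `ℝⁿ`. -/
def dualVec (b : Module.Basis (Fin n) ℤ Λ) (j : Fin n) : EuclideanSpace ℝ (Fin n) :=
  (InnerProductSpace.toDual ℝ _).symm
    (LinearMap.toContinuousLinearMap ((b.ofZLatticeBasis ℝ Λ).coord j))

theorem inner_dualVec (b : Module.Basis (Fin n) ℤ Λ) (j : Fin n) (x : EuclideanSpace ℝ (Fin n)) :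
    inner ℝ x (dualVec b j) = (b.ofZLatticeBasis ℝ Λ).repr x j := by
  rw [real_inner_comm, dualVec, InnerProductSpace.toDual_symm_apply]
  rfl

/-- The point of the dual lattice with coordinates `k`. -/
def dualPoint (b : Module.Basis (Fin n) ℤ Λ) (k : Fin n → ℝ) : EuclideanSpace ℝ (Fin n) :=
  ∑ j, k j • dualVec b j

/-- The point of the lattice with coordinates `m`. -/
def latticePoint (b : Module.Basis (Fin n) ℤ Λ) (m : Fin n → ℤ) : Λ := ∑ j, m j • b j

theorem coe_latticePoint (b : Module.Basis (Fin n) ℤ Λ) (m : Fin n → ℤ) :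
    (latticePoint b m : EuclideanSpace ℝ (Fin n)) =
      (b.ofZLatticeBasis ℝ Λ).equivFun.symm (fun j => (m j : ℝ)) := by
  simp only [latticePoint, Module.Basis.equivFun_symm_apply, Module.Basis.ofZLatticeBasis_apply,
    Submodule.coe_sum, Submodule.coe_smul]
  exact Finset.sum_congr rfl fun j _ => (Int.cast_smul_eq_zsmul ℝ _ _).symm

theorem repr_latticePoint (b : Module.Basis (Fin n) ℤ Λ) (m : Fin n → ℤ) (j : Fin n) :
    (b.ofZLatticeBasis ℝ Λ).repr (latticePoint b m : EuclideanSpace ℝ (Fin n)) j = m j := by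
  rw [coe_latticePoint, ← Module.Basis.equivFun_apply, LinearEquiv.apply_symm_apply]

theorem inner_dualPoint (b : Module.Basis (Fin n) ℤ Λ) (k : Fin n → ℝ)
    (x : EuclideanSpace ℝ (Fin n)) :
    inner ℝ x (dualPoint b k) = ∑ j, k j * (b.ofZLatticeBasis ℝ Λ).repr x j := by
  simp [dualPoint, inner_sum, inner_smul_right, inner_dualVec]

theorem inner_latticePoint_dualPoint (b : Module.Basis (Fin n) ℤ Λ) (m : Fin n → ℤ)
    (θ : Fin n → ℝ) :
    inner ℝ (latticePoint b m : EuclideanSpace ℝ (Fin n)) (dualPoint b θ) = ∑ j, θ j * m j := by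
  simp only [inner_dualPoint, repr_latticePoint]

/-- Uniqueness of Haar measure up to a factor. For a lattice basis `κ` is the reciprocal of the
covolume, but its value plays no role later. -/
theorem exists_integral_equivFun_symm (b : Module.Basis (Fin n) ℝ (EuclideanSpace ℝ (Fin n))) :
    ∃ κ : ℝ, ∀ f : EuclideanSpace ℝ (Fin n) → ℂ,
      ∫ x : Fin n → ℝ, f (b.equivFun.symm x) = κ * ∫ x, f x := by
  set e : (Fin n → ℝ) ≃L[ℝ] EuclideanSpace ℝ (Fin n) := b.equivFun.symm.toContinuousLinearEquiv
  have h1 := Measure.isAddLeftInvariant_eq_smul (Measure.map e volume)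
    (volume : Measure (EuclideanSpace ℝ (Fin n)))
  refine ⟨(Measure.addHaarScalarFactor (Measure.map e volume)
    (volume : Measure (EuclideanSpace ℝ (Fin n))) : NNReal), fun f => ?_⟩
  have h2 := e.toHomeomorph.measurableEmbedding.integral_map (μ := volume) f
  have h3 : (⇑e.toHomeomorph : (Fin n → ℝ) → _) = ⇑e := rfl
  rw [h3, h1, integral_smul_nnreal_measure] at h2
  exact h2.symm

/-- The Poisson summation formula for a lattice of `ℝⁿ`. -/
theorem exists_hasSum_poisson (b : Module.Basis (Fin n) ℤ Λ) :
    ∃ κ : ℝ, ∀ f : EuclideanSpace ℝ (Fin n) → ℂ, Continuous f → HasCompactSupport f →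
      Summable (fun k : Fin n → ℤ =>
        ∫ x, expChar (-inner ℝ x (dualPoint b fun j => k j)) * f x) →
      HasSum (fun k : Fin n → ℤ =>
        κ * ∫ x, expChar (-inner ℝ x (dualPoint b fun j => k j)) * f x)
        (∑' m : Fin n → ℤ, f (latticePoint b m)) := by
  obtain ⟨κ, hκ⟩ := exists_integral_equivFun_symm (b.ofZLatticeBasis ℝ Λ)
  refine ⟨κ, fun f hc hf hsum => ?_⟩
  set e : (Fin n → ℝ) ≃L[ℝ] EuclideanSpace ℝ (Fin n) :=
    (b.ofZLatticeBasis ℝ Λ).equivFun.symm.toContinuousLinearEquiv with he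
  have h0 : ∀ k : Fin n → ℤ, ∫ x : Fin n → ℝ, expChar (-∑ i, (k i : ℝ) * x i) * (f ∘ e) x =
      κ * ∫ x, expChar (-inner ℝ x (dualPoint b fun j => k j)) * f x := by
    intro k
    rw [← hκ]
    refine integral_congr_ae (Eventually.of_forall fun x => ?_)
    simp only [inner_dualPoint, ← Module.Basis.equivFun_apply, LinearEquiv.apply_symm_apply]
    rfl
  have h1 := hasSum_poisson_pi (f := f ∘ e) (hc.comp e.continuous)
    (hf.comp_homeomorph e.toHomeomorph) (by simpa only [h0] using hsum.mul_left (κ : ℂ))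
  simp only [h0] at h1
  convert h1 using 1
  refine tsum_congr fun m => ?_
  rw [coe_latticePoint]
  rfl

end Lattice

/-! ### Continuity in the Schwartz topology of smooth compactly supported families. -/

section Families

variable {Z V : Type*} [NormedAddCommGroup Z] [NormedSpace ℝ Z] [NormedAddCommGroup V]
  [NormedSpace ℝ V]

theorem iteratedFDeriv_partial {Φ : Z × V → ℂ} (hΦ : ContDiff ℝ ∞ Φ) (q : ℕ) (z : Z) (t : V) :
    iteratedFDeriv ℝ q (fun t => Φ (z, t)) t =
      (iteratedFDeriv ℝ q Φ (z, t)).compContinuousLinearMap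
        fun _ => ContinuousLinearMap.inr ℝ Z V := by
  have h1 : (fun t => Φ (z, t)) = (fun p => Φ ((z, 0) + p)) ∘ ContinuousLinearMap.inr ℝ Z V := by
    ext t; simp
  have h2 : ContDiff ℝ ∞ fun p : Z × V => Φ ((z, 0) + p) :=
    hΦ.comp (contDiff_const.add contDiff_id)
  rw [h1, ContinuousLinearMap.iteratedFDeriv_comp_right _ h2 _ (i := q) (mod_cast le_top),
    iteratedFDeriv_comp_add_left]
  simp

theorem continuous_iteratedFDeriv_partial {Φ : Z × V → ℂ} (hΦ : ContDiff ℝ ∞ Φ) (q : ℕ) :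
    Continuous fun p : Z × V => iteratedFDeriv ℝ q (fun t => Φ (p.1, t)) p.2 := by
  simp only [iteratedFDeriv_partial hΦ]
  exact (ContinuousMultilinearMap.compContinuousLinearMapL (F := ℂ)
    (fun _ : Fin q => ContinuousLinearMap.inr ℝ Z V)).continuous.comp
    (hΦ.continuous_iteratedFDeriv (m := q) (mod_cast le_top))

/-- A jointly smooth family of functions with locally uniformly compact supports depends
continuously on its parameter in the topology of `𝓢`. -/
theorem continuous_schwartz_family {Φ : Z × V → ℂ} (hΦ : ContDiff ℝ ∞ Φ)
    (hloc : ∀ z₀, ∃ K : Set V, IsCompact K ∧ ∀ᶠ z in 𝓝 z₀, ∀ t ∉ K, Φ (z, t) = 0)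
    {F : Z → 𝓢(V, ℂ)} (hF : ∀ z t, F z t = Φ (z, t)) : Continuous F := by
  rw [continuous_iff_continuousAt]
  intro z₀
  obtain ⟨K, hK, hloc⟩ := hloc z₀
  rw [ContinuousAt, (schwartz_withSeminorms ℂ V ℂ).tendsto_nhds]
  rintro ⟨p, q⟩ ε hε
  set Ψ : Z × V → ℝ := fun a => ‖a.2‖ ^ p * ‖iteratedFDeriv ℝ q (fun t => Φ (a.1, t)) a.2 -
    iteratedFDeriv ℝ q (fun t => Φ (z₀, t)) a.2‖ with hΨ
  have hc : Continuous Ψ := by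
    have h1 := continuous_iteratedFDeriv_partial hΦ q
    have h2 : Continuous fun a : Z × V => iteratedFDeriv ℝ q (fun t => Φ (z₀, t)) a.2 :=
      h1.comp (continuous_const.prodMk continuous_snd)
    exact (continuous_snd.norm.pow p).mul (h1.sub h2).norm
  -- Tube lemma: `Ψ` is jointly continuous and vanishes at `z = z₀`, so it is small on the compact
  -- set `K` for all `z` near `z₀`.
  have htube : ∀ᶠ z in 𝓝 z₀, ∀ t ∈ K, Ψ (z, t) < ε / 2 := by
    refine hK.eventually_forall_of_forall_eventually fun t _ => ?_
    refine hc.continuousAt.eventually (gt_mem_nhds ?_)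
    simpa [hΨ] using hε
  filter_upwards [htube, hloc] with z hz1 hz2
  refine lt_of_le_of_lt (SchwartzMap.seminorm_le_bound ℂ p q _ (half_pos hε).le fun t => ?_)
    (half_lt_self hε)
  have hF' : ∀ z, (F z : V → ℂ) = fun t => Φ (z, t) := fun z => funext (hF z)
  have hsub : ((F z - F z₀ : 𝓢(V, ℂ)) : V → ℂ) = (F z : V → ℂ) - F z₀ := rfl
  have hd : iteratedFDeriv ℝ q (F z - F z₀ : 𝓢(V, ℂ)) t =
      iteratedFDeriv ℝ q (fun t => Φ (z, t)) t - iteratedFDeriv ℝ q (fun t => Φ (z₀, t)) t := by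
    rw [hsub, iteratedFDeriv_sub_apply ((F z).smooth q).contDiffAt ((F z₀).smooth q).contDiffAt,
      hF', hF']
  rw [hd]
  by_cases ht : t ∈ K
  · exact (hz1 t ht).le
  -- The complement of `K` is open, so both functions vanish near `t` and so do all their
  -- derivatives there.
  · have hz3 := hloc.self_of_nhds
    have hev : ∀ {z}, (∀ t ∉ K, Φ (z, t) = 0) →
        iteratedFDeriv ℝ q (fun t => Φ (z, t)) t = 0 := by
      intro z hz
      have : (fun t => Φ (z, t)) =ᶠ[𝓝 t] fun _ => 0 := by
        filter_upwards [hK.isClosed.isOpen_compl.mem_nhds ht] with y hy using hz y hy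
      rw [(Filter.EventuallyEq.iteratedFDeriv ℝ this q).eq_of_nhds]
      simp
    rw [hev hz2, hev hz3]
    simpa using (half_pos hε).le

end Families

/-! ### Time-frequency shifts on Schwartz functions and their norms in E. -/

section TimeFrequency

variable {n : ℕ}

theorem schwartzModulation_apply' (ξ t : EuclideanSpace ℝ (Fin n))
    (φ : 𝓢(EuclideanSpace ℝ (Fin n), ℂ)) :
    schwartzModulation ξ φ t = expChar (inner ℝ t ξ) * φ t :=
  schwartzModulation_apply ξ t φ

/-- The twisted translation `T^B_x` as an operator on Schwartz functions. -/
def schwartzTwist (B : Matrix (Fin n) (Fin n) ℝ) (x : EuclideanSpace ℝ (Fin n)) :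
    𝓢(EuclideanSpace ℝ (Fin n), ℂ) →L[ℂ] 𝓢(EuclideanSpace ℝ (Fin n), ℂ) :=
  (SchwartzMap.compSubConstCLM ℂ x).comp (schwartzModulation (-(B.toEuclideanLin x)))

theorem schwartzTwist_apply (B : Matrix (Fin n) (Fin n) ℝ) (x t : EuclideanSpace ℝ (Fin n))
    (φ : 𝓢(EuclideanSpace ℝ (Fin n), ℂ)) :
    schwartzTwist B x φ t = twistedTranslation B x φ t := by
  rw [schwartzTwist, ContinuousLinearMap.comp_apply, SchwartzMap.compSubConstCLM_apply,
    schwartzModulation_apply', twistedTranslation, inner_neg_right, expChar_neg, mul_comm,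
    real_inner_comm]

theorem schwartzTwist_apply' (B : Matrix (Fin n) (Fin n) ℝ) (x t : EuclideanSpace ℝ (Fin n))
    (φ : 𝓢(EuclideanSpace ℝ (Fin n), ℂ)) :
    schwartzTwist B x φ t = expChar (-inner ℝ (B.toEuclideanLin x) (t - x)) * φ (t - x) := by
  rw [schwartzTwist_apply, twistedTranslation, expChar_neg, mul_comm]

theorem hasCompactSupport_schwartzTwist (B : Matrix (Fin n) (Fin n) ℝ)
    (x : EuclideanSpace ℝ (Fin n)) {φ : 𝓢(EuclideanSpace ℝ (Fin n), ℂ)}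
    (hφ : HasCompactSupport φ) : HasCompactSupport (schwartzTwist B x φ) := by
  have : (schwartzTwist B x φ : EuclideanSpace ℝ (Fin n) → ℂ) =
      fun t => expChar (-inner ℝ (B.toEuclideanLin x) (t - x)) * φ (t - x) :=
    funext fun t => schwartzTwist_apply' B x t φ
  rw [this]
  exact (hφ.comp_homeomorph (Homeomorph.subRight x)).mul_left

variable {E : Type*} [NormedAddCommGroup E] [NormedSpace ℂ E] [CompleteSpace E]

/-- The two polynomial bounds of a TMIB combined, with a single natural exponent so that they can be
matched against integer powers in the decay of the ambiguity function. -/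
theorem TMIB.norm_ofSchwartz_modulation_translation_le (hE : TMIB n E) :
    ∃ (C : ℝ) (r : ℕ), 0 ≤ C ∧ ∀ (z η : EuclideanSpace ℝ (Fin n))
      (φ : 𝓢(EuclideanSpace ℝ (Fin n), ℂ)),
      ‖hE.ofSchwartz (schwartzModulation η (SchwartzMap.compSubConstCLM ℂ z φ))‖ ≤
        C * (1 + ‖η‖) ^ r * (1 + ‖z‖) ^ r * ‖hE.ofSchwartz φ‖ := by
  obtain ⟨C₁, τ₁, hC₁, -, h₁⟩ := hE.translation_bound
  obtain ⟨C₂, τ₂, hC₂, -, h₂⟩ := hE.modulation_bound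
  set r := max ⌈τ₁⌉₊ ⌈τ₂⌉₊
  have hr : ∀ τ : ℝ, τ ≤ r → ∀ x : EuclideanSpace ℝ (Fin n), (1 + ‖x‖) ^ τ ≤ (1 + ‖x‖) ^ r := by
    intro τ hτ x
    rw [← Real.rpow_natCast]
    exact Real.rpow_le_rpow_of_exponent_le (by linarith [norm_nonneg x]) hτ
  have hτ₁ : τ₁ ≤ r := (Nat.le_ceil _).trans (by exact_mod_cast le_max_left _ _)
  have hτ₂ : τ₂ ≤ r := (Nat.le_ceil _).trans (by exact_mod_cast le_max_right _ _)
  refine ⟨C₂ * C₁, r, by positivity, fun z η φ => ?_⟩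
  have e₁ : hE.toDist (hE.ofSchwartz (SchwartzMap.compSubConstCLM ℂ z φ)) =
      distTranslation z (hE.toDist (hE.ofSchwartz φ)) := by
    ext ψ
    simp only [distTranslation, ContinuousLinearMap.comp_apply, hE.toDist_ofSchwartz,
      SchwartzMap.compSubConstCLM_apply]
    rw [← integral_add_right_eq_self _ z]
    simp
  -- The axiom bounds M_{-ξ}, so it is applied at ξ = -η; hence the double negation.
  have e₂ : hE.toDist (hE.ofSchwartz (schwartzModulation η (SchwartzMap.compSubConstCLM ℂ z φ))) =
      distModulation (- -η) (hE.toDist (hE.ofSchwartz (SchwartzMap.compSubConstCLM ℂ z φ))) := by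
    ext ψ
    simp only [distModulation, ContinuousLinearMap.comp_apply, hE.toDist_ofSchwartz,
      schwartzModulation_apply', neg_neg]
    refine integral_congr_ae (Eventually.of_forall fun t => ?_)
    dsimp only
    ring
  have b₁ := h₁ z _ _ e₁
  have b₂ := h₂ (-η) _ _ e₂
  rw [norm_neg] at b₂
  calc _ ≤ C₂ * (1 + ‖η‖) ^ τ₂ * (C₁ * (1 + ‖z‖) ^ τ₁ * ‖hE.ofSchwartz φ‖) :=
        b₂.trans (mul_le_mul_of_nonneg_left b₁ (by positivity))
    _ ≤ C₂ * (1 + ‖η‖) ^ r * (C₁ * (1 + ‖z‖) ^ r * ‖hE.ofSchwartz φ‖) := by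
        have b₃ := hr τ₁ hτ₁ z
        have b₄ := hr τ₂ hτ₂ η
        gcongr
    _ = _ := by ring

/-- Evaluation of a tempered distribution in `E` on a Schwartz function. -/
def TMIB.evalCLM (hE : TMIB n E) (ρ : 𝓢(EuclideanSpace ℝ (Fin n), ℂ)) : StrongDual ℂ E :=
  { toFun := fun x => hE.toDist x ρ
    map_add' := fun x y => by simp
    map_smul' := fun a x => by simp
    cont := (continuous_eval_const ρ).comp hE.toDist.continuous }

@[simp] theorem TMIB.evalCLM_apply (hE : TMIB n E) (ρ : 𝓢(EuclideanSpace ℝ (Fin n), ℂ)) (x : E) :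
    hE.evalCLM ρ x = hE.toDist x ρ := rfl

theorem TMIB.eq_of_compactSupport (hE : TMIB n E) {x y : E}
    (h : ∀ ρ : 𝓢(EuclideanSpace ℝ (Fin n), ℂ), HasCompactSupport ρ →
      hE.toDist x ρ = hE.toDist y ρ) : x = y := by
  apply hE.injective
  rw [← sub_eq_zero]
  exact tempered_eq_zero_of_compactSupport _ fun ρ hρ => by simp [h ρ hρ]

end TimeFrequency

/-! ### Decay and continuity of the cross-ambiguity function. -/

section Ambiguity

variable {n : ℕ}

theorem exists_apply_eq_zero_of_lt_norm {V : Type*} [NormedAddCommGroup V] {f : V → ℂ}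
    (hf : HasCompactSupport f) : ∃ R : ℝ, 0 ≤ R ∧ ∀ x, R < ‖x‖ → f x = 0 := by
  obtain ⟨R, hR⟩ := hf.isCompact.isBounded.exists_norm_le
  refine ⟨max R 0, le_max_right _ _, fun x hx => ?_⟩
  by_contra h
  exact (lt_of_le_of_lt (le_max_left R 0) hx).not_ge (hR x (subset_tsupport _ h))

/-- The cross-ambiguity function `∫ χ(u) ψ(u - z) e^{-2πi u·η} du`. -/
def ambiguity (χ ψ : 𝓢(EuclideanSpace ℝ (Fin n), ℂ)) (z η : EuclideanSpace ℝ (Fin n)) : ℂ :=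
  ∫ u, expChar (-inner ℝ u η) * (χ u * ψ (u - z))

theorem contDiff_schwartz (φ : 𝓢(EuclideanSpace ℝ (Fin n), ℂ)) : ContDiff ℝ ∞ φ := φ.smooth ⊤

theorem smulLeft_translate_apply (χ ψ : 𝓢(EuclideanSpace ℝ (Fin n), ℂ))
    (z u : EuclideanSpace ℝ (Fin n)) :
    SchwartzMap.smulLeftCLM ℂ χ (SchwartzMap.compSubConstCLM ℂ z ψ) u = χ u * ψ (u - z) := by
  rw [SchwartzMap.smulLeftCLM_apply_apply χ.hasTemperateGrowth, SchwartzMap.compSubConstCLM_apply,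
    smul_eq_mul]

/-- For fixed `z` the ambiguity function is the Fourier transform of χ · T_z ψ, hence Schwartz in
`η`. The product depends continuously on `z` in 𝓢 and vanishes once `z` leaves a ball, so
compactness makes the decay uniform in `z`. -/
theorem exists_ambiguity_bound {χ ψ : 𝓢(EuclideanSpace ℝ (Fin n), ℂ)} (hχ : HasCompactSupport χ)
    (hψ : HasCompactSupport ψ) (K : ℕ) :
    ∃ C R : ℝ, 0 ≤ C ∧ 0 ≤ R ∧ (∀ z, R < ‖z‖ → ∀ η, ambiguity χ ψ z η = 0) ∧
      ∀ z η, (1 + ‖η‖) ^ K * ‖ambiguity χ ψ z η‖ ≤ C := by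
  obtain ⟨R₁, hR₁, h₁⟩ := exists_apply_eq_zero_of_lt_norm hχ
  obtain ⟨R₂, hR₂, h₂⟩ := exists_apply_eq_zero_of_lt_norm hψ
  set F : EuclideanSpace ℝ (Fin n) → 𝓢(EuclideanSpace ℝ (Fin n), ℂ) := fun z =>
    SchwartzMap.smulLeftCLM ℂ χ (SchwartzMap.compSubConstCLM ℂ z ψ) with hF
  have hzero : ∀ z, R₁ + R₂ < ‖z‖ → ∀ η, ambiguity χ ψ z η = 0 := by
    intro z hz η
    rw [ambiguity]
    refine integral_eq_zero_of_ae (Eventually.of_forall fun u => ?_)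
    rcases lt_or_ge R₁ ‖u‖ with hu | hu
    · simp [h₁ u hu]
    · have : R₂ < ‖u - z‖ := by
        have := norm_sub_norm_le z u
        rw [norm_sub_rev] at this
        linarith
      simp [h₂ _ this]
  have hFc : Continuous F := by
    refine continuous_schwartz_family
      (Φ := fun p : EuclideanSpace ℝ (Fin n) × EuclideanSpace ℝ (Fin n) => χ p.2 * ψ (p.2 - p.1))
      (((contDiff_schwartz χ).comp contDiff_snd).mul
        ((contDiff_schwartz ψ).comp (contDiff_snd.sub contDiff_fst)))
      (fun z₀ => ⟨tsupport χ, hχ.isCompact, Eventually.of_forall fun z t ht => ?_⟩)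
      fun z t => smulLeft_translate_apply χ ψ z t
    simp [image_eq_zero_of_notMem_tsupport ht]
  have hfour : ∀ z η, SchwartzMap.fourierTransformCLM ℂ (F z) η = ambiguity χ ψ z η := by
    intro z η
    rw [SchwartzMap.fourierTransformCLM_apply, SchwartzMap.fourier_coe, Real.fourier_eq', ambiguity]
    refine integral_congr_ae (Eventually.of_forall fun u => ?_)
    dsimp only
    rw [hF, smulLeft_translate_apply, smul_eq_mul, expChar]
    congr 2
    push_cast
    ring
  -- Each Schwartz seminorm of the Fourier transform is continuous in `z`, hence bounded on the
  -- closed ball of radius `R₁ + R₂`.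
  have hsem : ∀ j : ℕ, ∃ C : ℝ, ∀ z, ‖z‖ ≤ R₁ + R₂ → ∀ η,
      ‖η‖ ^ j * ‖ambiguity χ ψ z η‖ ≤ C := by
    intro j
    have hc : Continuous fun z =>
        SchwartzMap.seminorm ℂ j 0 (SchwartzMap.fourierTransformCLM ℂ (F z)) :=
      ((schwartz_withSeminorms ℂ (EuclideanSpace ℝ (Fin n)) ℂ).continuous_seminorm (j, 0)).comp
        ((SchwartzMap.fourierTransformCLM ℂ).continuous.comp hFc)
    obtain ⟨C, hC⟩ := (isCompact_closedBall (0 : EuclideanSpace ℝ (Fin n))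
      (R₁ + R₂)).exists_bound_of_continuousOn hc.continuousOn
    refine ⟨C, fun z hz η => ?_⟩
    rw [← hfour]
    exact (SchwartzMap.norm_pow_mul_le_seminorm ℂ _ j η).trans
      ((Real.le_norm_self _).trans (hC z (by simpa using hz)))
  obtain ⟨C₀, hC₀⟩ := hsem 0
  obtain ⟨C₁, hC₁⟩ := hsem K
  have hpow : ∀ x : ℝ, 0 ≤ x → (1 + x) ^ K ≤ 2 ^ K * (1 + x ^ K) := by
    intro x hx
    rcases le_total x 1 with h | h
    · calc (1 + x) ^ K ≤ 2 ^ K := pow_le_pow_left₀ (by linarith) (by linarith) K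
        _ ≤ 2 ^ K * (1 + x ^ K) := le_mul_of_one_le_right (by positivity)
          (by linarith [pow_nonneg hx K])
    · calc (1 + x) ^ K ≤ (2 * x) ^ K := pow_le_pow_left₀ (by linarith) (by linarith) K
        _ = 2 ^ K * x ^ K := mul_pow _ _ _
        _ ≤ _ := by gcongr; linarith
  refine ⟨max (2 ^ K * (C₀ + C₁)) 0, R₁ + R₂, le_max_right _ _, by positivity, hzero,
    fun z η => ?_⟩
  rcases lt_or_ge (R₁ + R₂) ‖z‖ with hz | hz
  · simp [hzero z hz]
  · refine le_trans ?_ (le_max_left _ _)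
    have a₀ := hC₀ z hz η
    have a₁ := hC₁ z hz η
    rw [pow_zero, one_mul] at a₀
    calc (1 + ‖η‖) ^ K * ‖ambiguity χ ψ z η‖
        ≤ 2 ^ K * (1 + ‖η‖ ^ K) * ‖ambiguity χ ψ z η‖ :=
          mul_le_mul_of_nonneg_right (hpow _ (norm_nonneg _)) (norm_nonneg _)
      _ = 2 ^ K * (‖ambiguity χ ψ z η‖ + ‖η‖ ^ K * ‖ambiguity χ ψ z η‖) := by ring
      _ ≤ _ := by gcongr

theorem continuous_ambiguity {χ : 𝓢(EuclideanSpace ℝ (Fin n), ℂ)} (hχ : HasCompactSupport χ)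
    (ψ : 𝓢(EuclideanSpace ℝ (Fin n), ℂ))
    {η : EuclideanSpace ℝ (Fin n) → EuclideanSpace ℝ (Fin n)} (hη : ContDiff ℝ ∞ η) :
    Continuous fun z => ambiguity χ ψ z (η z) := by
  have hFc : Continuous fun z => schwartzModulation (-(η z))
      (SchwartzMap.smulLeftCLM ℂ χ (SchwartzMap.compSubConstCLM ℂ z ψ)) := by
    refine continuous_schwartz_family
      (Φ := fun p : EuclideanSpace ℝ (Fin n) × EuclideanSpace ℝ (Fin n) =>
        expChar (-inner ℝ p.2 (η p.1)) * (χ p.2 * ψ (p.2 - p.1)))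
      ((contDiff_expChar.comp (contDiff_snd.inner ℝ (hη.comp contDiff_fst)).neg).mul
        (((contDiff_schwartz χ).comp contDiff_snd).mul
        ((contDiff_schwartz ψ).comp (contDiff_snd.sub contDiff_fst))))
      (fun z₀ => ⟨tsupport χ, hχ.isCompact, Eventually.of_forall fun z t ht => ?_⟩)
      fun z t => ?_
    · simp [image_eq_zero_of_notMem_tsupport ht]
    · rw [schwartzModulation_apply', smulLeft_translate_apply, inner_neg_right]
  refine ((SchwartzMap.integralCLM ℂ volume).continuous.comp hFc).congr fun z => ?_
  rw [Function.comp, SchwartzMap.integralCLM_apply, ambiguity]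
  refine integral_congr_ae (Eventually.of_forall fun u => ?_)
  dsimp only
  rw [schwartzModulation_apply', smulLeft_translate_apply, inner_neg_right]

/-- Needed so that the E-valued integrand `z ↦ V(z, η(z)) M_{η(z)} T_z φ` is continuous and
therefore Bochner integrable. -/
theorem continuous_modulation_translation {φ : 𝓢(EuclideanSpace ℝ (Fin n), ℂ)}
    (hφ : HasCompactSupport φ)
    {η : EuclideanSpace ℝ (Fin n) → EuclideanSpace ℝ (Fin n)} (hη : ContDiff ℝ ∞ η) :
    Continuous fun z => schwartzModulation (η z) (SchwartzMap.compSubConstCLM ℂ z φ) := by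
  obtain ⟨R, hR, h⟩ := exists_apply_eq_zero_of_lt_norm hφ
  refine continuous_schwartz_family
      (Φ := fun p : EuclideanSpace ℝ (Fin n) × EuclideanSpace ℝ (Fin n) =>
        expChar (inner ℝ p.2 (η p.1)) * φ (p.2 - p.1))
      ((contDiff_expChar.comp (contDiff_snd.inner ℝ (hη.comp contDiff_fst))).mul
        ((contDiff_schwartz φ).comp (contDiff_snd.sub contDiff_fst)))
      (fun z₀ => ⟨Metric.closedBall 0 (R + ‖z₀‖ + 1), isCompact_closedBall _ _, ?_⟩)
      fun z t => ?_
  · filter_upwards [(isOpen_lt continuous_norm continuous_const).mem_nhds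
      (show ‖z₀‖ < ‖z₀‖ + 1 by linarith)] with z hz t ht
    have hz : ‖z‖ < ‖z₀‖ + 1 := hz
    have ht : R + ‖z₀‖ + 1 < ‖t‖ := by simpa using ht
    have := norm_sub_norm_le t z
    simp [h (t - z) (by linarith)]
  · rw [schwartzModulation_apply', SchwartzMap.compSubConstCLM_apply]

end Ambiguity

/-! ### Summability over the dual lattice and finiteness in balls. -/

section DualLattice

variable {n : ℕ} {Λ : Submodule ℤ (EuclideanSpace ℝ (Fin n))} [DiscreteTopology Λ] [IsZLattice ℝ Λ]

theorem summable_inv_one_add_norm_int (n : ℕ) :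
    Summable fun k : Fin n → ℤ => ((1 + ‖fun j => (k j : ℝ)‖) ^ (n + 1))⁻¹ := by
  set bs := Pi.basisFun ℝ (Fin n)
  set L := Submodule.span ℤ (Set.range bs)
  set bz : Module.Basis (Fin n) ℤ L := bs.restrictScalars ℤ
  have hrank : Module.finrank ℤ L = n := by
    rw [Module.finrank_eq_card_basis bz, Fintype.card_fin]
  have h1 := ZLattice.summable_norm_pow_inv L (n + 1) (by omega)
  have h2 := (bz.equivFun.symm.toEquiv.summable_iff).2 h1
  have h3 : ∀ k : Fin n → ℤ, ((bz.equivFun.symm k : L) : Fin n → ℝ) = fun j => (k j : ℝ) := by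
    intro k
    ext j
    have : ∀ x, ((bz x : L) : Fin n → ℝ) j = if j = x then 1 else 0 := fun x => by
      rw [Module.Basis.restrictScalars_apply, Pi.basisFun_apply, Pi.single_apply]
    simp [Module.Basis.equivFun_symm_apply, this]
  -- The comparison fails only at `k = 0`, where the convention `0⁻¹ = 0` makes the majorant vanish.
  refine Summable.of_norm_bounded_eventually h2 ?_
  refine (Set.finite_singleton (0 : Fin n → ℤ)).subset fun k hk => ?_
  by_contra hk0
  apply hk
  have h4 : 0 < ‖fun j => (k j : ℝ)‖ := by
    rw [norm_pos_iff]
    intro h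
    apply hk0
    ext j
    simpa using congrFun h j
  have h5 : ‖(bz.equivFun.symm k : L)‖ = ‖fun j => (k j : ℝ)‖ := by
    rw [← h3 k]; rfl
  simp only [Function.comp, LinearEquiv.coe_toEquiv, mem_ofPred_eq]
  change ‖((1 + ‖fun j => (k j : ℝ)‖) ^ (n + 1))⁻¹‖ ≤ ‖(bz.equivFun.symm k : L)‖⁻¹ ^ (n + 1)
  rw [h5, Real.norm_of_nonneg (by positivity), inv_pow]
  gcongr
  linarith

theorem summable_inv_one_add_norm_dualPoint (b : Module.Basis (Fin n) ℤ Λ) :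
    Summable fun k : Fin n → ℤ => ((1 + ‖dualPoint b fun j => (k j : ℝ)‖) ^ (n + 1))⁻¹ := by
  -- The coordinate k_j is the inner product of the dual point with b_j, which bounds ‖k‖ by
  -- Cauchy–Schwarz; the extra 1 gives 1 + ‖k‖ ≤ D (1 + ‖μ_k‖).
  set D : ℝ := 1 + ∑ j, ‖(b j : EuclideanSpace ℝ (Fin n))‖ with hD
  have hD1 : 1 ≤ D := by
    have : 0 ≤ ∑ j, ‖(b j : EuclideanSpace ℝ (Fin n))‖ := Finset.sum_nonneg fun _ _ => norm_nonneg _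
    linarith
  have hnorm : ∀ k : Fin n → ℤ, ‖fun j => (k j : ℝ)‖ ≤ D * ‖dualPoint b fun j => (k j : ℝ)‖ := by
    intro k
    refine (pi_norm_le_iff_of_nonneg (by positivity)).2 fun j => ?_
    have hb := (Module.Basis.ofZLatticeBasis_apply ℝ Λ b j).symm
    have h1 : (k j : ℝ) = inner ℝ (b j : EuclideanSpace ℝ (Fin n)) (dualPoint b fun j => (k j : ℝ)) := by
      rw [inner_dualPoint, Finset.sum_eq_single j]
      · rw [hb, Module.Basis.repr_self, Finsupp.single_eq_same, mul_one]
      · intro i _ hi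
        rw [hb, Module.Basis.repr_self, Finsupp.single_eq_of_ne hi, mul_zero]
      · simp
    rw [h1]
    refine (norm_inner_le_norm _ _).trans (mul_le_mul_of_nonneg_right ?_ (norm_nonneg _))
    have := Finset.single_le_sum (f := fun j => ‖(b j : EuclideanSpace ℝ (Fin n))‖)
      (fun _ _ => norm_nonneg _) (Finset.mem_univ j)
    linarith
  refine Summable.of_nonneg_of_le (fun k => by positivity) (fun k => ?_)
    ((summable_inv_one_add_norm_int n).mul_left (D ^ (n + 1)))
  rw [← div_eq_mul_inv, inv_eq_one_div, div_le_div_iff₀ (by positivity) (by positivity), one_mul,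
    ← mul_pow]
  refine pow_le_pow_left₀ (by positivity) ?_ _
  nlinarith [hnorm k]

theorem exists_finset_latticePoint (b : Module.Basis (Fin n) ℤ Λ) (R : ℝ) :
    ∃ s : Finset (Fin n → ℤ), ∀ m ∉ s, R < ‖(latticePoint b m : EuclideanSpace ℝ (Fin n))‖ := by
  set D : ℝ := ∑ j, ‖dualVec b j‖
  refine ⟨Fintype.piFinset fun _ => Finset.Icc (-⌈R * D⌉) ⌈R * D⌉, fun m hm => ?_⟩
  by_contra! h
  apply hm
  rw [Fintype.mem_piFinset]
  intro j
  have h1 : |(m j : ℝ)| ≤ R * D := by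
    rw [← repr_latticePoint b m j, ← inner_dualVec]
    refine (abs_real_inner_le_norm _ _).trans (mul_le_mul h ?_ (norm_nonneg _)
      ((norm_nonneg _).trans h))
    exact Finset.single_le_sum (f := fun j => ‖dualVec b j‖)
      (fun _ _ => norm_nonneg _) (Finset.mem_univ j)
  rw [Finset.mem_Icc]
  have h5 := abs_le.1 (h1.trans (Int.le_ceil _))
  exact ⟨by exact_mod_cast h5.1, by exact_mod_cast h5.2⟩

end DualLattice

/-! ### Boundedness of the twisted frame-type operators via Poisson summation. -/

section Frame

variable {n : ℕ} {Λ : Submodule ℤ (EuclideanSpace ℝ (Fin n))} [DiscreteTopology Λ] [IsZLattice ℝ Λ]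

/-- The transpose of `B`, as a linear map of `ℝⁿ`. -/
def transposeCLM (B : Matrix (Fin n) (Fin n) ℝ) :
    EuclideanSpace ℝ (Fin n) →L[ℝ] EuclideanSpace ℝ (Fin n) :=
  LinearMap.toContinuousLinearMap (LinearMap.adjoint B.toEuclideanLin)

theorem inner_transposeCLM (B : Matrix (Fin n) (Fin n) ℝ) (x y : EuclideanSpace ℝ (Fin n)) :
    inner ℝ x (transposeCLM B y) = inner ℝ (B.toEuclideanLin x) y :=
  LinearMap.adjoint_inner_right _ _ _

/-- The frequencies `-(μ_k + Bᵀ z + ξ)`, where `μ_k` runs over the dual lattice. -/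
def frequency (b : Module.Basis (Fin n) ℤ Λ) (B : Matrix (Fin n) (Fin n) ℝ)
    (ξ : EuclideanSpace ℝ (Fin n)) (k : Fin n → ℤ) (z : EuclideanSpace ℝ (Fin n)) :
    EuclideanSpace ℝ (Fin n) :=
  -((dualPoint b fun j => (k j : ℝ)) + (transposeCLM B z + ξ))

theorem contDiff_frequency (b : Module.Basis (Fin n) ℤ Λ) (B : Matrix (Fin n) (Fin n) ℝ)
    (ξ : EuclideanSpace ℝ (Fin n)) (k : Fin n → ℤ) : ContDiff ℝ ∞ (frequency b B ξ k) :=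
  (contDiff_const.add ((transposeCLM B).contDiff.add contDiff_const)).neg

/-- Ambiguity decay of order r + n + 1 is split: r powers absorb the growth of M_η on E, and n + 1
powers make the sum over the dual lattice converge. The trade between η and μ_k is possible because
they differ by Bᵀz + ξ up to sign, which is bounded when `z` lies in the support and ‖ξ‖ ≤ Ξ. -/
theorem exists_ambiguity_frequency_bound (b : Module.Basis (Fin n) ℤ Λ)
    (B : Matrix (Fin n) (Fin n) ℝ) {χ ψ : 𝓢(EuclideanSpace ℝ (Fin n), ℂ)}
    (hχ : HasCompactSupport χ) (hψ : HasCompactSupport ψ) (Ξ : ℝ) (r : ℕ) :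
    ∃ M R : ℝ, 0 ≤ M ∧ 0 ≤ R ∧ (∀ z, R < ‖z‖ → ∀ η, ambiguity χ ψ z η = 0) ∧
      ∀ ξ, ‖ξ‖ ≤ Ξ → ∀ z k, ‖ambiguity χ ψ z (frequency b B ξ k z)‖ *
        (1 + ‖frequency b B ξ k z‖) ^ r ≤
          M * ((1 + ‖dualPoint b fun j => (k j : ℝ)‖) ^ (n + 1))⁻¹ := by
  obtain ⟨C, R, hC, hR, hzero, hbd⟩ := exists_ambiguity_bound hχ hψ (r + (n + 1))
  set D : ℝ := 1 + ‖transposeCLM B‖ * R + max Ξ 0 with hD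
  have hD0 : 0 ≤ D := by positivity
  refine ⟨C * D ^ (n + 1), R, by positivity, hR, hzero, fun ξ hξ z k => ?_⟩
  rcases lt_or_ge R ‖z‖ with hz | hz
  · rw [hzero z hz, norm_zero, zero_mul]
    positivity
  set μ := dualPoint b fun j => (k j : ℝ)
  set η := frequency b B ξ k z with hη
  have h1 : ‖transposeCLM B z + ξ‖ ≤ ‖transposeCLM B‖ * R + max Ξ 0 := by
    refine (norm_add_le _ _).trans (add_le_add ?_ (hξ.trans (le_max_left _ _)))
    exact ((transposeCLM B).le_opNorm z).trans (mul_le_mul_of_nonneg_left hz (norm_nonneg _))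
  have h2 : μ = -η - (transposeCLM B z + ξ) := by
    rw [hη, frequency]; abel
  have h3 : ‖μ‖ ≤ ‖η‖ + ‖transposeCLM B z + ξ‖ := by
    rw [h2]
    exact (norm_sub_le _ _).trans (by rw [norm_neg])
  have h4 : 1 + ‖μ‖ ≤ D * (1 + ‖η‖) := by
    have : 0 ≤ (‖transposeCLM B‖ * R + max Ξ 0) * ‖η‖ := by positivity
    nlinarith [norm_nonneg η]
  have h5 := hbd z η
  rw [← div_eq_mul_inv, le_div_iff₀ (by positivity)]
  calc _ ≤ ‖ambiguity χ ψ z η‖ * (1 + ‖η‖) ^ r * (D * (1 + ‖η‖)) ^ (n + 1) := by gcongr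
    _ = (1 + ‖η‖) ^ (r + (n + 1)) * ‖ambiguity χ ψ z η‖ * D ^ (n + 1) := by
      rw [mul_pow, pow_add]; ring
    _ ≤ _ := by gcongr

/-- The factor ρ confines t, and then z = t - (t - z) is confined by the support of φ. -/
theorem hasCompactSupport_translate_mul {φ ρ : 𝓢(EuclideanSpace ℝ (Fin n), ℂ)}
    (hφ : HasCompactSupport φ) (hρ : HasCompactSupport ρ) :
    HasCompactSupport fun p : EuclideanSpace ℝ (Fin n) × EuclideanSpace ℝ (Fin n) =>
      φ (p.2 - p.1) * ρ p.2 := by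
  obtain ⟨R₁, hR₁, h₁⟩ := exists_apply_eq_zero_of_lt_norm hφ
  obtain ⟨R₂, hR₂, h₂⟩ := exists_apply_eq_zero_of_lt_norm hρ
  refine HasCompactSupport.intro ((isCompact_closedBall 0 (R₁ + R₂)).prod
    (isCompact_closedBall 0 R₂)) fun p hp => ?_
  rw [Set.mem_prod, not_and_or] at hp
  simp only [mem_closedBall_zero_iff, not_le] at hp
  rcases lt_or_ge R₂ ‖p.2‖ with h | h
  · rw [h₂ _ h, mul_zero]
  · have h3 : R₁ + R₂ < ‖p.1‖ := hp.resolve_right h.not_gt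
    have h4 := norm_sub_norm_le p.1 p.2
    rw [norm_sub_rev] at h4
    rw [h₁ _ (by linarith), zero_mul]

/-- Poisson summation for the kernel of `f ↦ ∑_λ e^{-2πiλ·ξ} ⟨f, T^{-B}_λ ψ⟩ T^B_λ χ`. -/
theorem hasSum_kernel (b : Module.Basis (Fin n) ℤ Λ) (B : Matrix (Fin n) (Fin n) ℝ)
    {χ ψ : 𝓢(EuclideanSpace ℝ (Fin n), ℂ)} (hχ : HasCompactSupport χ) (hψ : HasCompactSupport ψ)
    {κ : ℝ} (hκ : ∀ f : EuclideanSpace ℝ (Fin n) → ℂ, Continuous f → HasCompactSupport f →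
      Summable (fun k : Fin n → ℤ =>
        ∫ x, expChar (-inner ℝ x (dualPoint b fun j => k j)) * f x) →
      HasSum (fun k : Fin n → ℤ =>
        κ * ∫ x, expChar (-inner ℝ x (dualPoint b fun j => k j)) * f x)
        (∑' m : Fin n → ℤ, f (latticePoint b m))) (ξ z t : EuclideanSpace ℝ (Fin n)) :
    HasSum (fun k : Fin n → ℤ => (κ : ℂ) * (expChar (inner ℝ t (frequency b B ξ k z)) *
        ambiguity χ ψ z (frequency b B ξ k z)))
      (∑' m : Fin n → ℤ, expChar (-inner ℝ (latticePoint b m : EuclideanSpace ℝ (Fin n))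
        (transposeCLM B z + ξ)) * (χ (t - latticePoint b m) * ψ (t - latticePoint b m - z))) := by
  set f : EuclideanSpace ℝ (Fin n) → ℂ := fun x =>
    expChar (-inner ℝ x (transposeCLM B z + ξ)) * (χ (t - x) * ψ (t - x - z)) with hf
  have hfc : Continuous f := by
    have h1 := χ.continuous
    have h2 := ψ.continuous
    fun_prop
  have hfs : HasCompactSupport f :=
    ((hχ.comp_homeomorph (Homeomorph.subLeft t)).mul_right).mul_left
  have hcoef : ∀ k : Fin n → ℤ,
      ∫ x, expChar (-inner ℝ x (dualPoint b fun j => (k j : ℝ))) * f x =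
        expChar (inner ℝ t (frequency b B ξ k z)) * ambiguity χ ψ z (frequency b B ξ k z) := by
    intro k
    rw [ambiguity, ← integral_sub_left_eq_self _ volume t, ← integral_const_mul]
    refine integral_congr_ae (Eventually.of_forall fun u => ?_)
    simp only [hf, sub_sub_cancel, frequency]
    have h := expChar_add (-inner ℝ (t - u) (dualPoint b fun j => (k j : ℝ)))
      (-inner ℝ (t - u) (transposeCLM B z + ξ))
    have h' := expChar_add (inner ℝ t (-((dualPoint b fun j => (k j : ℝ)) + (transposeCLM B z + ξ))))
      (-inner ℝ u (-((dualPoint b fun j => (k j : ℝ)) + (transposeCLM B z + ξ))))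
    have h'' : -inner ℝ (t - u) (dualPoint b fun j => (k j : ℝ)) +
        -inner ℝ (t - u) (transposeCLM B z + ξ) =
        inner ℝ t (-((dualPoint b fun j => (k j : ℝ)) + (transposeCLM B z + ξ))) +
          -inner ℝ u (-((dualPoint b fun j => (k j : ℝ)) + (transposeCLM B z + ξ))) := by
      simp only [inner_sub_left, inner_neg_right, inner_add_right]
      ring
    rw [h'', h'] at h
    linear_combination (-(χ u * ψ (u - z))) * h
  have := hκ f hfc hfs ?_
  · simpa only [hcoef] using this
  · simp only [hcoef]
    obtain ⟨M, R, -, -, -, hM⟩ := exists_ambiguity_frequency_bound b B hχ hψ ‖ξ‖ 0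
    refine Summable.of_norm_bounded ((summable_inv_one_add_norm_dualPoint b).mul_left M)
      fun k => ?_
    simpa using hM ξ le_rfl z k

/-- Substituting s = t - z, the opposite twists give -Bλ·(t - λ) + Bλ·(s - λ) = -λ·Bᵀz, so the
double integral factors into the two pairings. -/
theorem integral_kernel (B : Matrix (Fin n) (Fin n) ℝ) {χ ψ φ ρ : 𝓢(EuclideanSpace ℝ (Fin n), ℂ)}
    (hφ : HasCompactSupport φ) (hρ : HasCompactSupport ρ) (l ξ : EuclideanSpace ℝ (Fin n)) :
    Integrable (fun p : EuclideanSpace ℝ (Fin n) × EuclideanSpace ℝ (Fin n) =>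
      expChar (-inner ℝ l (transposeCLM B p.1 + ξ)) * (χ (p.2 - l) * ψ (p.2 - l - p.1)) *
        (φ (p.2 - p.1) * ρ p.2)) (volume.prod volume) ∧
    ∫ p : EuclideanSpace ℝ (Fin n) × EuclideanSpace ℝ (Fin n),
      expChar (-inner ℝ l (transposeCLM B p.1 + ξ)) * (χ (p.2 - l) * ψ (p.2 - l - p.1)) *
        (φ (p.2 - p.1) * ρ p.2) ∂(volume.prod volume) =
      expChar (-inner ℝ l ξ) * (∫ s, schwartzTwist (-B) l ψ s * φ s) *
        ∫ t, schwartzTwist B l χ t * ρ t := by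
  have hint : Integrable (fun p : EuclideanSpace ℝ (Fin n) × EuclideanSpace ℝ (Fin n) =>
      expChar (-inner ℝ l (transposeCLM B p.1 + ξ)) * (χ (p.2 - l) * ψ (p.2 - l - p.1)) *
        (φ (p.2 - p.1) * ρ p.2)) (volume.prod volume) := by
    refine Continuous.integrable_of_hasCompactSupport ?_
      (hasCompactSupport_translate_mul hφ hρ).mul_left
    have h1 := χ.continuous
    have h2 := ψ.continuous
    have h3 := φ.continuous
    have h4 := ρ.continuous
    fun_prop
  refine ⟨hint, ?_⟩
  rw [integral_prod_symm _ hint, ← integral_const_mul]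
  refine integral_congr_ae (Eventually.of_forall fun t => ?_)
  dsimp only
  rw [← integral_sub_left_eq_self _ volume t, mul_right_comm, ← integral_const_mul]
  refine integral_congr_ae (Eventually.of_forall fun s => ?_)
  simp only [schwartzTwist_apply', sub_sub_cancel]
  have h1 : t - l - (t - s) = s - l := by abel
  have h2 : expChar (-inner ℝ l (transposeCLM B (t - s) + ξ)) =
      expChar (-inner ℝ l ξ) * expChar (-inner ℝ ((-B).toEuclideanLin l) (s - l)) *
        expChar (-inner ℝ (B.toEuclideanLin l) (t - l)) := by
    rw [← expChar_add, ← expChar_add, inner_add_right, inner_transposeCLM]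
    congr 1
    simp only [map_neg, LinearMap.neg_apply, inner_neg_left, inner_sub_right]
    ring
  rw [h1, h2]
  ring

/-- The weak form of the representation of A_ξ φ by time-frequency shifts: the Poisson identity for
the kernel is integrated against φ(t - z) ρ(t), and the decay of the ambiguity function permits
exchanging the sum over the dual lattice with the integral. -/
theorem hasSum_pairing (b : Module.Basis (Fin n) ℤ Λ) (B : Matrix (Fin n) (Fin n) ℝ)
    {χ ψ : 𝓢(EuclideanSpace ℝ (Fin n), ℂ)} (hχ : HasCompactSupport χ) (hψ : HasCompactSupport ψ)
    {κ : ℝ} (hκ : ∀ f : EuclideanSpace ℝ (Fin n) → ℂ, Continuous f → HasCompactSupport f →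
      Summable (fun k : Fin n → ℤ =>
        ∫ x, expChar (-inner ℝ x (dualPoint b fun j => k j)) * f x) →
      HasSum (fun k : Fin n → ℤ =>
        κ * ∫ x, expChar (-inner ℝ x (dualPoint b fun j => k j)) * f x)
        (∑' m : Fin n → ℤ, f (latticePoint b m))) (ξ : EuclideanSpace ℝ (Fin n))
    {φ ρ : 𝓢(EuclideanSpace ℝ (Fin n), ℂ)} (hφ : HasCompactSupport φ) (hρ : HasCompactSupport ρ)
    {s : Finset (Fin n → ℤ)}
    (hs : ∀ m ∉ s, ∫ t, schwartzTwist (-B) (latticePoint b m) ψ t * φ t = 0) :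
    HasSum (fun k : Fin n → ℤ => (κ : ℂ) * ∫ z, ambiguity χ ψ z (frequency b B ξ k z) *
        ∫ t, schwartzModulation (frequency b B ξ k z) (SchwartzMap.compSubConstCLM ℂ z φ) t * ρ t)
      (∑ m ∈ s, expChar (-inner ℝ (latticePoint b m : EuclideanSpace ℝ (Fin n)) ξ) *
        (∫ t, schwartzTwist (-B) (latticePoint b m) ψ t * φ t) *
          ∫ t, schwartzTwist B (latticePoint b m) χ t * ρ t) := by
  classical
  have hφc := φ.continuous
  have hρc := ρ.continuous
  have hcs := hasCompactSupport_translate_mul hφ hρ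
  have hcc : Continuous fun p : EuclideanSpace ℝ (Fin n) × EuclideanSpace ℝ (Fin n) =>
      φ (p.2 - p.1) * ρ p.2 := by fun_prop
  set g : (Fin n → ℤ) → EuclideanSpace ℝ (Fin n) × EuclideanSpace ℝ (Fin n) → ℂ := fun k p =>
    (κ : ℂ) * (expChar (inner ℝ p.2 (frequency b B ξ k p.1)) *
      ambiguity χ ψ p.1 (frequency b B ξ k p.1)) * (φ (p.2 - p.1) * ρ p.2) with hg
  have hgi : ∀ k, Integrable (g k) (volume.prod volume) := by
    intro k
    have h1 := (continuous_ambiguity hχ ψ (contDiff_frequency b B ξ k)).comp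
      (continuous_fst (X := EuclideanSpace ℝ (Fin n)) (Y := EuclideanSpace ℝ (Fin n)))
    have h2 := (contDiff_frequency b B ξ k).continuous
    have h3 : Continuous (g k) :=
      (continuous_const.mul ((continuous_expChar.comp
        (continuous_snd.inner (h2.comp continuous_fst))).mul h1)).mul hcc
    exact h3.integrable_of_hasCompactSupport hcs.mul_left
  obtain ⟨M, R, hM0, -, -, hM⟩ := exists_ambiguity_frequency_bound b B hχ hψ ‖ξ‖ 0
  have hgs : Summable fun k => ∫ p, ‖g k p‖ ∂(volume.prod volume) := by
    refine Summable.of_nonneg_of_le (fun k => integral_nonneg fun p => norm_nonneg _) (fun k => ?_)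
      ((summable_inv_one_add_norm_dualPoint b).mul_left (|κ| * M *
        ∫ p : EuclideanSpace ℝ (Fin n) × EuclideanSpace ℝ (Fin n),
          ‖φ (p.2 - p.1) * ρ p.2‖ ∂(volume.prod volume)))
    rw [mul_right_comm, ← integral_const_mul]
    refine integral_mono (hgi k).norm ((hcc.integrable_of_hasCompactSupport hcs).norm.const_mul _)
      fun p => ?_
    dsimp only [hg]
    rw [norm_mul, norm_mul, norm_mul, norm_expChar, one_mul, Complex.norm_real, Real.norm_eq_abs,
      mul_assoc |κ| M]
    have := hM ξ le_rfl p.1 k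
    rw [pow_zero, mul_one] at this
    gcongr
  have hsum := hasSum_integral_of_summable_integral_norm hgi hgs
  obtain ⟨R₁, hR₁, h₁⟩ := exists_apply_eq_zero_of_lt_norm hχ
  obtain ⟨R₂, hR₂, h₂⟩ := exists_apply_eq_zero_of_lt_norm hρ
  -- Only finitely many translates of the support of χ meet that of ρ; enlarging `s` by these
  -- indices makes the lattice sum finite at every point, and the added terms integrate to zero.
  obtain ⟨s', hs'⟩ := exists_finset_latticePoint b (R₁ + R₂)
  have hval : ∫ p, ∑' k, g k p ∂(volume.prod volume) =
      ∑ m ∈ s ∪ s', expChar (-inner ℝ (latticePoint b m : EuclideanSpace ℝ (Fin n)) ξ) *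
        (∫ t, schwartzTwist (-B) (latticePoint b m) ψ t * φ t) *
          ∫ t, schwartzTwist B (latticePoint b m) χ t * ρ t := by
    simp only [← (integral_kernel B (χ := χ) (ψ := ψ) hφ hρ _ ξ).2]
    rw [← integral_finsetSum _ fun m _ => (integral_kernel B hφ hρ _ ξ).1]
    refine integral_congr_ae (Eventually.of_forall fun p => ?_)
    dsimp only
    have hk := (hasSum_kernel b B hχ hψ hκ ξ p.1 p.2).mul_right (φ (p.2 - p.1) * ρ p.2)
    rw [show ∑' k, g k p = _ from hk.tsum_eq]
    rcases lt_or_ge R₂ ‖p.2‖ with h | h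
    · simp [h₂ _ h]
    · rw [tsum_eq_sum (s := s ∪ s'), Finset.sum_mul]
      intro m hm
      have hm' : m ∉ s' := fun h => hm (Finset.mem_union_right _ h)
      have h4 := hs' m hm'
      have h5 := norm_sub_norm_le (latticePoint b m : EuclideanSpace ℝ (Fin n)) p.2
      rw [norm_sub_rev] at h5
      rw [h₁ _ (by linarith)]
      simp
  have hss : ∑ m ∈ s ∪ s', expChar (-inner ℝ (latticePoint b m : EuclideanSpace ℝ (Fin n)) ξ) *
        (∫ t, schwartzTwist (-B) (latticePoint b m) ψ t * φ t) *
          ∫ t, schwartzTwist B (latticePoint b m) χ t * ρ t =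
      ∑ m ∈ s, expChar (-inner ℝ (latticePoint b m : EuclideanSpace ℝ (Fin n)) ξ) *
        (∫ t, schwartzTwist (-B) (latticePoint b m) ψ t * φ t) *
          ∫ t, schwartzTwist B (latticePoint b m) χ t * ρ t := by
    refine (Finset.sum_subset Finset.subset_union_left fun m _ hm => ?_).symm
    rw [hs m hm]; simp
  rw [hval, hss] at hsum
  refine hsum.congr_fun fun k => ?_
  rw [integral_prod _ (hgi k), ← integral_const_mul]
  refine integral_congr_ae (Eventually.of_forall fun z => ?_)
  dsimp only [hg]
  rw [← integral_const_mul, ← integral_const_mul]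
  refine integral_congr_ae (Eventually.of_forall fun t => ?_)
  dsimp only
  rw [schwartzModulation_apply', SchwartzMap.compSubConstCLM_apply]
  ring

variable {E : Type*} [NormedAddCommGroup E] [NormedSpace ℂ E] [CompleteSpace E]

/-- The operators `f ↦ ∑_λ e^{-2πiλ·ξ} ⟨f, T^{-B}_λ ψ⟩ T^B_λ χ` are bounded in the norm of `E`,
uniformly for bounded `ξ`. -/
theorem TMIB.exists_norm_sum_le (hE : TMIB n E) (b : Module.Basis (Fin n) ℤ Λ)
    (B : Matrix (Fin n) (Fin n) ℝ) {χ ψ : 𝓢(EuclideanSpace ℝ (Fin n), ℂ)}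
    (hχ : HasCompactSupport χ) (hψ : HasCompactSupport ψ) (Ξ : ℝ) :
    ∃ C : ℝ, 0 ≤ C ∧ ∀ ξ, ‖ξ‖ ≤ Ξ → ∀ φ : 𝓢(EuclideanSpace ℝ (Fin n), ℂ), HasCompactSupport φ →
      ∀ s : Finset (Fin n → ℤ),
        (∀ m ∉ s, ∫ t, schwartzTwist (-B) (latticePoint b m) ψ t * φ t = 0) →
        ‖∑ m ∈ s, (expChar (-inner ℝ (latticePoint b m : EuclideanSpace ℝ (Fin n)) ξ) *
          ∫ t, schwartzTwist (-B) (latticePoint b m) ψ t * φ t) •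
            hE.ofSchwartz (schwartzTwist B (latticePoint b m) χ)‖ ≤ C * ‖hE.ofSchwartz φ‖ := by
  obtain ⟨κ, hκ⟩ := exists_hasSum_poisson b
  obtain ⟨D, r, hD, hbd⟩ := hE.norm_ofSchwartz_modulation_translation_le
  obtain ⟨M, R, hM0, hR0, hzero, hM⟩ := exists_ambiguity_frequency_bound b B hχ hψ Ξ r
  set w : (Fin n → ℤ) → ℝ := fun k => ((1 + ‖dualPoint b fun j => (k j : ℝ)‖) ^ (n + 1))⁻¹ with hw
  -- Collects the Poisson factor, the ambiguity decay, the TMIB bound with ‖z‖ ≤ R, and the volume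
  -- of the ball of integration.
  set A : ℝ := |κ| * (M * D * (1 + R) ^ r *
    volume.real (Metric.closedBall (0 : EuclideanSpace ℝ (Fin n)) R)) with hA
  have hA0 : 0 ≤ A := by positivity
  refine ⟨A * ∑' k, w k, mul_nonneg hA0 (tsum_nonneg fun k => by positivity),
    fun ξ hξ φ hφ s hs => ?_⟩
  set v : (Fin n → ℤ) → EuclideanSpace ℝ (Fin n) → E := fun k z =>
    ambiguity χ ψ z (frequency b B ξ k z) • hE.ofSchwartz
      (schwartzModulation (frequency b B ξ k z) (SchwartzMap.compSubConstCLM ℂ z φ)) with hv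
  have hvz : ∀ k z, R < ‖z‖ → v k z = 0 := fun k z hz => by simp [hv, hzero z hz]
  have hvi : ∀ k, Integrable (v k) := by
    intro k
    refine Continuous.integrable_of_hasCompactSupport ?_
      (HasCompactSupport.intro (isCompact_closedBall 0 R) fun z hz => hvz k z (by simpa using hz))
    exact (continuous_ambiguity hχ ψ (contDiff_frequency b B ξ k)).smul
      (hE.ofSchwartz.continuous.comp
        (continuous_modulation_translation hφ (contDiff_frequency b B ξ k)))
  have hvn : ∀ k, ‖(κ : ℂ) • ∫ z, v k z‖ ≤ A * ‖hE.ofSchwartz φ‖ * w k := by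
    intro k
    rw [← setIntegral_eq_integral_of_forall_compl_eq_zero (s := Metric.closedBall 0 R)
      fun z hz => hvz k z (by simpa using hz)]
    have hpt : ∀ z ∈ Metric.closedBall (0 : EuclideanSpace ℝ (Fin n)) R,
        ‖v k z‖ ≤ M * w k * D * (1 + R) ^ r * ‖hE.ofSchwartz φ‖ := by
      intro z hz
      have hz : ‖z‖ ≤ R := by simpa using hz
      calc ‖v k z‖ ≤ ‖ambiguity χ ψ z (frequency b B ξ k z)‖ *
            (D * (1 + ‖frequency b B ξ k z‖) ^ r * (1 + ‖z‖) ^ r * ‖hE.ofSchwartz φ‖) := by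
            rw [hv, norm_smul]
            exact mul_le_mul_of_nonneg_left (hbd _ _ _) (norm_nonneg _)
        _ = ‖ambiguity χ ψ z (frequency b B ξ k z)‖ * (1 + ‖frequency b B ξ k z‖) ^ r *
            (D * (1 + ‖z‖) ^ r * ‖hE.ofSchwartz φ‖) := by ring
        _ ≤ M * w k * (D * (1 + R) ^ r * ‖hE.ofSchwartz φ‖) := by
            have := hM ξ hξ z k
            gcongr
        _ = _ := by ring
    have h1 := norm_setIntegral_le_of_norm_le_const (μ := volume)
      (measure_closedBall_lt_top) hpt
    rw [norm_smul, Complex.norm_real, Real.norm_eq_abs]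
    calc _ ≤ |κ| * _ := mul_le_mul_of_nonneg_left h1 (abs_nonneg _)
      _ = _ := by rw [hA]; ring
  have hws : Summable w := summable_inv_one_add_norm_dualPoint b
  have hsum : Summable fun k => (κ : ℂ) • ∫ z, v k z :=
    Summable.of_norm_bounded (hws.mul_left _) hvn
  -- The E-valued series converges absolutely; it is identified with the finite sum by testing both
  -- against compactly supported ρ.
  have heq : ∑' k, (κ : ℂ) • ∫ z, v k z =
      ∑ m ∈ s, (expChar (-inner ℝ (latticePoint b m : EuclideanSpace ℝ (Fin n)) ξ) *
          ∫ t, schwartzTwist (-B) (latticePoint b m) ψ t * φ t) •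
            hE.ofSchwartz (schwartzTwist B (latticePoint b m) χ) := by
    refine hE.eq_of_compactSupport fun ρ hρ => ?_
    have h1 := (hE.evalCLM ρ).hasSum hsum.hasSum
    refine h1.unique ?_
    have h2 := hasSum_pairing b B hχ hψ hκ ξ hφ hρ hs
    have h3 : ∀ k, hE.evalCLM ρ ((κ : ℂ) • ∫ z, v k z) =
        κ * ∫ z, ambiguity χ ψ z (frequency b B ξ k z) * ∫ t, schwartzModulation
          (frequency b B ξ k z) (SchwartzMap.compSubConstCLM ℂ z φ) t * ρ t := by
      intro k
      rw [map_smul, ← ContinuousLinearMap.integral_comp_comm _ (hvi k), smul_eq_mul]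
      congr 1
      refine integral_congr_ae (Eventually.of_forall fun z => ?_)
      simp only [hv, map_smul, smul_eq_mul, TMIB.evalCLM_apply, hE.toDist_ofSchwartz]
    have h4 : hE.toDist (∑ m ∈ s,
        (expChar (-inner ℝ (latticePoint b m : EuclideanSpace ℝ (Fin n)) ξ) *
          ∫ t, schwartzTwist (-B) (latticePoint b m) ψ t * φ t) •
            hE.ofSchwartz (schwartzTwist B (latticePoint b m) χ)) ρ =
        ∑ m ∈ s, expChar (-inner ℝ (latticePoint b m : EuclideanSpace ℝ (Fin n)) ξ) *
          (∫ t, schwartzTwist (-B) (latticePoint b m) ψ t * φ t) *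
            ∫ t, schwartzTwist B (latticePoint b m) χ t * ρ t := by
      rw [← TMIB.evalCLM_apply]
      simp only [map_sum, map_smul, smul_eq_mul, TMIB.evalCLM_apply, hE.toDist_ofSchwartz]
    simp only [h3]
    rw [h4]
    exact h2
  rw [← heq]
  calc _ ≤ ∑' k, A * ‖hE.ofSchwartz φ‖ * w k :=
        tsum_of_norm_bounded (hws.mul_left _).hasSum hvn
    _ = _ := by rw [tsum_mul_left]; ring

end Frame

/-! ### Césaro weights as averages of characters. -/

section Fejer

/-- The one-dimensional Césaro weights `(1 - |m|/N)₊`. -/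
def cesaroWeight (N : ℕ) (m : ℤ) : ℝ :=
  if m ∈ Finset.Ioo (-(N : ℤ)) (N : ℤ) then 1 - |(m : ℝ)| / N else 0

theorem tendsto_cesaroWeight (m : ℤ) : Tendsto (fun N => cesaroWeight N m) atTop (𝓝 1) := by
  have h1 : Tendsto (fun N : ℕ => 1 - |(m : ℝ)| / N) atTop (𝓝 1) := by
    simpa using (tendsto_const_div_atTop_nhds_zero_nat |(m : ℝ)|).const_sub 1
  refine h1.congr' ?_
  filter_upwards [eventually_gt_atTop m.natAbs] with N hN
  rw [cesaroWeight, if_pos]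
  rw [Finset.mem_Ioo]
  omega

theorem sum_expChar_roots {q : ℕ} {j : ℤ} (hj : |j| < q) :
    ∑ k ∈ Finset.range q, expChar (k * j / q) = if j = 0 then (q : ℂ) else 0 := by
  split_ifs with h
  · simp [h]
  · have hq : (q : ℝ) ≠ 0 := by
      have : (0 : ℤ) < q := (abs_nonneg j).trans_lt hj
      exact_mod_cast this.ne'
    have hpow : ∀ k : ℕ, expChar (k * j / q) = expChar (j / q) ^ k := by
      intro k
      rw [expChar, expChar, ← Complex.exp_nat_mul]
      congr 1
      push_cast
      ring
    have hne : expChar (j / q) ≠ 1 := by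
      intro h1
      rw [expChar, Complex.exp_eq_one_iff] at h1
      obtain ⟨a, ha⟩ := h1
      have h2 : ((j / q : ℝ) : ℂ) = a := by
        have := Complex.two_pi_I_ne_zero
        exact mul_left_cancel₀ this (by rw [ha]; ring)
      have h3 : (j / q : ℝ) = a := by exact_mod_cast h2
      rw [div_eq_iff hq] at h3
      have h4 : j = a * q := by exact_mod_cast h3
      rw [h4, abs_mul, Nat.abs_cast] at hj
      have h5 : a ≠ 0 := by
        rintro rfl
        exact h (by simpa using h4)
      have h6 : (1 : ℤ) ≤ |a| := Int.one_le_abs h5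
      nlinarith
    simp only [hpow]
    have h1 := mul_geom_sum (expChar (j / q)) q
    rw [← hpow q, mul_div_assoc, mul_div_cancel₀ _ hq, expChar_int, sub_self] at h1
    exact (mul_eq_zero.1 h1).resolve_left (sub_ne_zero.2 hne)

/-- Counts the pairs in {0, …, N-1}² with difference m: there are N - |m| of them when |m| < N and
none otherwise. -/
theorem card_sub_eq (N : ℕ) (m : ℤ) :
    (∑ a ∈ Finset.range N, ∑ c ∈ Finset.range N, if ((a : ℤ) - c - m) = 0 then (1 : ℂ) else 0) =
      N * cesaroWeight N m := by
  have h1 : ∀ a ∈ Finset.range N,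
      (∑ c ∈ Finset.range N, if ((a : ℤ) - c - m) = 0 then (1 : ℂ) else 0) =
        if 0 ≤ (a : ℤ) - m ∧ (a : ℤ) - m < N then 1 else 0 := by
    intro a _
    split_ifs with h
    · rw [Finset.sum_eq_single ((a : ℤ) - m).toNat]
      · rw [if_pos]; omega
      · intro c _ hc
        rw [if_neg]; omega
      · intro hc
        rw [Finset.mem_range] at hc
        omega
    · refine Finset.sum_eq_zero fun c hc => ?_
      rw [Finset.mem_range] at hc
      rw [if_neg]; omega
  rw [Finset.sum_congr rfl h1, Finset.sum_ite, Finset.sum_const_zero, add_zero, Finset.sum_const,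
    nsmul_one]
  have h2 : (Finset.range N).filter (fun a : ℕ => 0 ≤ (a : ℤ) - m ∧ (a : ℤ) - m < N) =
      Finset.Ico m.toNat (min N ((N : ℤ) + m).toNat) := by
    ext a
    simp only [Finset.mem_filter, Finset.mem_range, Finset.mem_Ico]
    omega
  rw [h2, Nat.card_Ico, cesaroWeight]
  split_ifs with h
  · rw [Finset.mem_Ioo] at h
    have hN : (N : ℝ) ≠ 0 := by
      have : N ≠ 0 := by omega
      exact_mod_cast this
    have h3 : ((min N ((N : ℤ) + m).toNat - m.toNat : ℕ) : ℤ) = N - |m| := by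
      rcases abs_cases m with ⟨h5, h6⟩ | ⟨h5, h6⟩ <;> omega
    have h4 : ((min N ((N : ℤ) + m).toNat - m.toNat : ℕ) : ℝ) = N * (1 - |(m : ℝ)| / N) := by
      rw [mul_sub, mul_one, mul_div_cancel₀ _ hN]
      exact_mod_cast h3
    exact_mod_cast h4
  · rw [Finset.mem_Ioo] at h
    have h3 : min N ((N : ℤ) + m).toNat - m.toNat = 0 := by omega
    rw [h3]; simp

/-- The Césaro weights are convex combinations of characters. -/
theorem exists_cesaroWeight_eq_sum {N : ℕ} (hN : 0 < N) (M : ℕ) :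
    ∃ (q : ℕ) (K θ : ℕ → ℝ), (∀ k, 0 ≤ K k) ∧ ∑ k ∈ Finset.range q, K k = 1 ∧
      (∀ k ∈ Finset.range q, |θ k| ≤ 1) ∧ ∀ m : ℤ, |m| ≤ M →
        ∑ k ∈ Finset.range q, (K k : ℂ) * expChar (-(θ k * m)) = cesaroWeight N m := by
  -- For a, c < N and |m| ≤ M one has |a - c - m| < N + M, so congruence to zero modulo `q` means
  -- equality and no wrap-around occurs.
  set q := N + M with hq
  have hq0 : (q : ℝ) ≠ 0 := by
    have : q ≠ 0 := by omega
    exact_mod_cast this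
  have hN0 : (N : ℂ) ≠ 0 := by
    exact_mod_cast hN.ne'
  have hq0' : (q : ℂ) ≠ 0 := by exact_mod_cast hq0
  -- The Fejér kernel sampled at the points k/q. It is non-negative as a squared modulus; its total
  -- mass 1 is the identity at m = 0.
  set K : ℕ → ℝ := fun k => ‖∑ a ∈ Finset.range N, expChar (k * a / q)‖ ^ 2 / (q * N) with hK
  have hKc : ∀ k, (K k : ℂ) = (∑ a ∈ Finset.range N, ∑ c ∈ Finset.range N,
      expChar (k * a / q) * expChar (-(k * c / q))) / (q * N) := by
    intro k
    simp only [hK]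
    push_cast
    rw [← Complex.mul_conj', map_sum, Finset.sum_mul_sum]
    simp only [expChar_conj]
  have hmain : ∀ m : ℤ, |m| ≤ M →
      ∑ k ∈ Finset.range q, (K k : ℂ) * expChar (-((k / q : ℝ) * m)) = cesaroWeight N m := by
    intro m hm
    have h1 : ∀ k ∈ Finset.range q, (K k : ℂ) * expChar (-((k / q : ℝ) * m)) =
        (∑ a ∈ Finset.range N, ∑ c ∈ Finset.range N,
          expChar (k * ((a - c - m : ℤ) : ℝ) / q)) / (q * N) := by
      intro k _
      rw [hKc, div_mul_eq_mul_div, Finset.sum_mul]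
      congr 1
      refine Finset.sum_congr rfl fun a _ => ?_
      rw [Finset.sum_mul]
      refine Finset.sum_congr rfl fun c _ => ?_
      rw [← expChar_add, ← expChar_add]
      congr 1
      push_cast
      ring
    rw [Finset.sum_congr rfl h1, ← Finset.sum_div, Finset.sum_comm]
    have h2 : ∀ a ∈ Finset.range N, (∑ k ∈ Finset.range q, ∑ c ∈ Finset.range N,
        expChar (k * ((a - c - m : ℤ) : ℝ) / q)) =
        ∑ c ∈ Finset.range N, q * if ((a : ℤ) - c - m) = 0 then (1 : ℂ) else 0 := by
      intro a ha
      rw [Finset.sum_comm]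
      refine Finset.sum_congr rfl fun c hc => ?_
      rw [Finset.mem_range] at ha hc
      rw [sum_expChar_roots]
      · split_ifs <;> simp
      · rw [abs_lt]
        rw [abs_le] at hm
        omega
    rw [Finset.sum_congr rfl h2]
    simp only [← Finset.mul_sum]
    rw [card_sub_eq]
    field_simp
  refine ⟨q, K, fun k => k / q, fun k => by positivity, ?_, fun k hk => ?_, hmain⟩
  · have h := hmain 0 (by simp)
    rw [cesaroWeight, if_pos (by rw [Finset.mem_Ioo]; omega)] at h
    simp at h
    exact_mod_cast h
  · rw [Finset.mem_range] at hk
    rw [abs_of_nonneg (by positivity)]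
    refine div_le_one_of_le₀ ?_ (by positivity)
    exact_mod_cast hk.le

variable {n : ℕ} {V : Type*} [NormedAddCommGroup V] [NormedSpace ℂ V]

/-- The cube `{m | ∀ j, |m_j| < N}`. -/
def cesaroBox (n N : ℕ) : Finset (Fin n → ℤ) :=
  Fintype.piFinset fun _ : Fin n => Finset.Ioo (-(N : ℤ)) (N : ℤ)

/-- Moves the truncation into the weight, so that the index set no longer depends on N. -/
theorem sum_cesaroBox_eq (N : ℕ) {x : (Fin n → ℤ) → V} {s : Finset (Fin n → ℤ)}
    (hs : ∀ m ∉ s, x m = 0) :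
    ∑ m ∈ cesaroBox n N, ((∏ j, (1 - |(m j : ℝ)| / (N : ℝ)) : ℝ) : ℂ) • x m =
      ∑ m ∈ s, ((∏ j, cesaroWeight N (m j) : ℝ) : ℂ) • x m := by
  classical
  have h1 : ∀ m ∈ cesaroBox n N, ((∏ j, (1 - |(m j : ℝ)| / (N : ℝ)) : ℝ) : ℂ) • x m =
      ((∏ j, cesaroWeight N (m j) : ℝ) : ℂ) • x m := by
    intro m hm
    rw [cesaroBox, Fintype.mem_piFinset] at hm
    congr 3
    exact funext fun j => by rw [cesaroWeight, if_pos (hm j)]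
  rw [Finset.sum_congr rfl h1, Finset.sum_subset (Finset.subset_union_left (s₂ := s)),
    ← Finset.sum_subset (Finset.subset_union_right (s₁ := cesaroBox n N))]
  · intro m _ hm
    rw [hs m hm, smul_zero]
  · intro m _ hm
    rw [cesaroBox, Fintype.mem_piFinset, not_forall] at hm
    obtain ⟨j, hj⟩ := hm
    rw [Finset.prod_eq_zero (Finset.mem_univ j) (by rw [cesaroWeight, if_neg hj])]
    simp

theorem tendsto_sum_cesaroBox {x : (Fin n → ℤ) → V} {s : Finset (Fin n → ℤ)}
    (hs : ∀ m ∉ s, x m = 0) :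
    Tendsto (fun N => ∑ m ∈ cesaroBox n N, ((∏ j, (1 - |(m j : ℝ)| / (N : ℝ)) : ℝ) : ℂ) • x m)
      atTop (𝓝 (∑ m ∈ s, x m)) := by
  simp only [sum_cesaroBox_eq _ hs]
  refine tendsto_finsetSum _ fun m _ => ?_
  have h1 : Tendsto (fun N => ∏ j, cesaroWeight N (m j)) atTop (𝓝 (∏ _j : Fin n, 1)) :=
    tendsto_finsetProd _ fun j _ => tendsto_cesaroWeight (m j)
  rw [Finset.prod_const_one] at h1
  have h2 := ((Complex.continuous_ofReal.tendsto 1).comp h1).smul_const (x m)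
  simpa using h2

/-- Césaro means are bounded by the supremum of the twists of a sequence by characters. -/
theorem norm_sum_cesaroBox_le {x : (Fin n → ℤ) → V} {s : Finset (Fin n → ℤ)}
    (hs : ∀ m ∉ s, x m = 0) {C : ℝ} (hC : 0 ≤ C)
    (h : ∀ θ : Fin n → ℝ, (∀ j, |θ j| ≤ 1) → ‖∑ m ∈ s, expChar (-∑ j, θ j * m j) • x m‖ ≤ C)
    (N : ℕ) :
    ‖∑ m ∈ cesaroBox n N, ((∏ j, (1 - |(m j : ℝ)| / (N : ℝ)) : ℝ) : ℂ) • x m‖ ≤ C := by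
  rw [sum_cesaroBox_eq N hs]
  -- At N = 0 the box is empty unless n = 0, when it has one point with weight the empty product 1.
  rcases Nat.eq_zero_or_pos N with rfl | hN
  · rcases Nat.eq_zero_or_pos n with rfl | hn
    · have := h 0 (by simp)
      simpa using this
    · have : ∀ m ∈ s, ((∏ j, cesaroWeight 0 (m j) : ℝ) : ℂ) • x m = 0 := by
        intro m _
        rw [Finset.prod_eq_zero (Finset.mem_univ ⟨0, hn⟩) (by simp [cesaroWeight])]
        simp
      rw [Finset.sum_eq_zero this, norm_zero]
      exact hC
  obtain ⟨M, hM⟩ : ∃ M : ℕ, ∀ m ∈ s, ∀ j, |m j| ≤ M := by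
    refine ⟨∑ m ∈ s, ∑ j, (m j).natAbs, fun m hm j => ?_⟩
    rw [Int.abs_eq_natAbs]
    have h1 : (m j).natAbs ≤ ∑ j, (m j).natAbs :=
      Finset.single_le_sum (f := fun j => (m j).natAbs) (fun _ _ => Nat.zero_le _)
        (Finset.mem_univ j)
    have h2 : ∑ j, (m j).natAbs ≤ ∑ m ∈ s, ∑ j, (m j).natAbs :=
      Finset.single_le_sum (f := fun m : Fin n → ℤ => ∑ j, (m j).natAbs)
        (fun _ _ => Nat.zero_le _) hm
    exact_mod_cast h1.trans h2
  obtain ⟨q, K, θ, hK0, hK1, hθ, hK⟩ := exists_cesaroWeight_eq_sum hN M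
  set I : Finset (Fin n → ℕ) := Fintype.piFinset fun _ => Finset.range q with hI
  have h1 : ∀ m ∈ s, ((∏ j, cesaroWeight N (m j) : ℝ) : ℂ) • x m =
      ∑ k ∈ I, ((∏ j, K (k j) : ℝ) : ℂ) • expChar (-∑ j, θ (k j) * m j) • x m := by
    intro m hm
    push_cast
    rw [Finset.prod_congr rfl fun j _ => (hK (m j) (hM m hm j)).symm, Finset.prod_univ_sum,
      Finset.sum_smul]
    refine Finset.sum_congr rfl fun k _ => ?_
    rw [Finset.prod_mul_distrib, smul_smul, ← Finset.sum_neg_distrib, expChar_sum]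
  rw [Finset.sum_congr rfl h1, Finset.sum_comm]
  simp only [← Finset.smul_sum]
  -- The product weights are again a probability vector, so the mean is a convex combination of the
  -- twisted sums bounded in `h`.
  have hKI : ∑ k ∈ I, ∏ j, K (k j) = 1 := by
    rw [hI, ← Finset.prod_univ_sum]
    simp [hK1]
  calc _ ≤ ∑ k ∈ I, ‖((∏ j, K (k j) : ℝ) : ℂ) • ∑ m ∈ s, expChar (-∑ j, θ (k j) * m j) • x m‖ :=
        norm_sum_le _ _
    _ ≤ ∑ k ∈ I, (∏ j, K (k j)) * C := by
        refine Finset.sum_le_sum fun k hk => ?_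
        rw [norm_smul, Complex.norm_real, Real.norm_of_nonneg (Finset.prod_nonneg fun j _ => hK0 _)]
        refine mul_le_mul_of_nonneg_left (h _ fun j => ?_) (Finset.prod_nonneg fun j _ => hK0 _)
        exact hθ _ (Fintype.mem_piFinset.1 hk j)
    _ = C := by rw [← Finset.sum_mul, hKI, one_mul]

end Fejer

/-! ### Density by duality and strong limits of bounded operators. -/

/-- Hahn–Banach: a point outside the closure survives in the quotient and is detected there by a
functional, which pulls back to one vanishing on `D`. -/
theorem dense_of_forall_dual_eq_zero {E : Type*} [NormedAddCommGroup E] [NormedSpace ℂ E]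
    (D : Submodule ℂ E) (h : ∀ f : StrongDual ℂ E, (∀ x ∈ D, f x = 0) → f = 0) :
    Dense (D : Set E) := by
  rw [Submodule.dense_iff_topologicalClosure_eq_top, Submodule.eq_top_iff']
  intro x
  by_contra hx
  set Dc := D.topologicalClosure with hDc
  have : IsClosed (Dc : Set E) := D.isClosed_topologicalClosure
  have hx' : Dc.mkQ x ≠ 0 := by
    rwa [ne_eq, Submodule.mkQ_apply, Submodule.Quotient.mk_eq_zero]
  obtain ⟨g, hg⟩ := SeparatingDual.exists_ne_zero (R := ℂ) hx'
  have h1 := h (g.comp Dc.mkQL) fun y hy => by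
    have : Dc.mkQL y = 0 := by
      simpa using D.le_topologicalClosure hy
    simp [this]
  exact hg (DFunLike.congr_fun h1 x)

/-- The uniform bound passes from `D` to all of E by density, and an ε/3 argument then propagates
convergence; Banach–Steinhaus makes the limit continuous. -/
theorem exists_tendsto_of_dense {E F : Type*} [NormedAddCommGroup E] [NormedSpace ℂ E]
    [CompleteSpace E] [NormedAddCommGroup F] [NormedSpace ℂ F] [CompleteSpace F] {D : Set E} (hD : Dense D)
    (T : ℕ → E →L[ℂ] F) {C : ℝ} (hC : 0 ≤ C) (hT : ∀ N, ∀ x ∈ D, ‖T N x‖ ≤ C * ‖x‖)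
    (hconv : ∀ x ∈ D, ∃ y, Tendsto (fun N => T N x) atTop (𝓝 y)) :
    ∃ P : E →L[ℂ] F, ∀ x, Tendsto (fun N => T N x) atTop (𝓝 (P x)) := by
  have hT' : ∀ N x, ‖T N x‖ ≤ C * ‖x‖ := fun N x =>
    hD.induction (P := fun x => ‖T N x‖ ≤ C * ‖x‖) (hT N)
      (isClosed_le (T N).continuous.norm (continuous_const.mul continuous_norm)) x
  have hlim : ∀ x, ∃ y, Tendsto (fun N => T N x) atTop (𝓝 y) := by
    intro x
    refine cauchySeq_tendsto_of_complete (Metric.cauchySeq_iff'.2 fun ε hε => ?_)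
    -- C + 1 rather than C avoids division by zero.
    obtain ⟨y, hy, hxy⟩ := Metric.mem_closure_iff.1 (hD x) (ε / (3 * (C + 1))) (by positivity)
    obtain ⟨z, hz⟩ := hconv y hy
    obtain ⟨N₀, hN₀⟩ := Metric.cauchySeq_iff'.1 hz.cauchySeq (ε / 3) (by positivity)
    refine ⟨N₀, fun N hN => ?_⟩
    have h1 : ∀ N, dist (T N x) (T N y) ≤ ε / 3 := by
      intro N
      rw [dist_eq_norm, ← map_sub]
      refine (hT' N _).trans ?_
      rw [← dist_eq_norm]
      calc C * dist x y ≤ (C + 1) * (ε / (3 * (C + 1))) := by gcongr; linarith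
        _ = ε / 3 := by field_simp
    have h2 := hN₀ N hN
    calc dist (T N x) (T N₀ x) ≤ dist (T N x) (T N y) + dist (T N y) (T N₀ y) +
          dist (T N₀ y) (T N₀ x) := dist_triangle4 _ _ _ _
      _ < ε / 3 + ε / 3 + ε / 3 := by
          have h3 := h1 N
          have h4 := h1 N₀
          rw [dist_comm] at h4
          linarith
      _ = ε := by ring
  choose f hf using hlim
  have ht : Tendsto (fun N x => T N x) atTop (𝓝 f) := tendsto_pi_nhds.2 hf
  exact ⟨continuousLinearMapOfTendsto T ht, hf⟩

/-! ### The frame operator on E as a strong Césaro limit. -/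

section Operators

variable {n : ℕ} {Λ : Submodule ℤ (EuclideanSpace ℝ (Fin n))}
  {E : Type*} [NormedAddCommGroup E] [NormedSpace ℂ E] [CompleteSpace E]

/-- The image in `E` of the compactly supported smooth functions. -/
def TMIB.testSubmodule (hE : TMIB n E) : Submodule ℂ E where
  carrier := {x | ∃ φ : 𝓢(EuclideanSpace ℝ (Fin n), ℂ), HasCompactSupport φ ∧ hE.ofSchwartz φ = x}
  zero_mem' := ⟨0, HasCompactSupport.zero, map_zero _⟩
  add_mem' := by
    rintro _ _ ⟨φ, hφ, rfl⟩ ⟨ψ, hψ, rfl⟩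
    exact ⟨φ + ψ, hφ.add hψ, map_add _ _ _⟩
  smul_mem' := by
    rintro a _ ⟨φ, hφ, rfl⟩
    exact ⟨a • φ, hφ.smul_left (f := fun _ => a), map_smul _ _ _⟩

/-- A functional in E' that kills test functions is zero as a tempered distribution, hence zero
because E' embeds in 𝓢'. -/
theorem TMIB.dense_testSubmodule (hE : TMIB n E) : Dense (hE.testSubmodule : Set E) := by
  refine dense_of_forall_dual_eq_zero _ fun f hf => hE.dual.injective ?_
  rw [map_zero]
  exact tempered_eq_zero_of_compactSupport _ fun φ hφ => hf _ ⟨φ, hφ, rfl⟩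

/-- The lattice points correspond to their coordinates. -/
def latticeEquiv (b : Module.Basis (Fin n) ℤ Λ) : (Fin n → ℤ) ≃ Λ := b.equivFun.symm.toEquiv

@[simp] theorem latticeEquiv_apply (b : Module.Basis (Fin n) ℤ Λ) (m : Fin n → ℤ) :
    latticeEquiv b m = latticePoint b m := b.equivFun_symm_apply m

theorem TMIB.toDist_ofSchwartz' (hE : TMIB n E) (φ ψ : 𝓢(EuclideanSpace ℝ (Fin n), ℂ)) :
    hE.toDist (hE.ofSchwartz φ) ψ = ∫ t, ψ t * φ t := by
  simp only [hE.toDist_ofSchwartz, mul_comm]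

/-- The Césaro means of the operator `f ↦ ∑_λ ⟨f, T^{-B}_λ ψ⟩ T^B_λ χ`. -/
def TMIB.cesaroOp (hE : TMIB n E) (b : Module.Basis (Fin n) ℤ Λ) (B : Matrix (Fin n) (Fin n) ℝ)
    (χ ψ : 𝓢(EuclideanSpace ℝ (Fin n), ℂ)) (N : ℕ) : E →L[ℂ] E :=
  ∑ m ∈ cesaroBox n N, ((∏ j, (1 - |(m j : ℝ)| / (N : ℝ)) : ℝ) : ℂ) •
    (hE.evalCLM (schwartzTwist (-B) (latticePoint b m) ψ)).smulRight
      (hE.ofSchwartz (schwartzTwist B (latticePoint b m) χ))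

theorem TMIB.cesaroOp_apply (hE : TMIB n E) (b : Module.Basis (Fin n) ℤ Λ)
    (B : Matrix (Fin n) (Fin n) ℝ) (χ ψ : 𝓢(EuclideanSpace ℝ (Fin n), ℂ)) (N : ℕ) (f : E) :
    hE.cesaroOp b B χ ψ N f =
      ∑ m ∈ cesaroBox n N, ((∏ j, (1 - |(m j : ℝ)| / (N : ℝ)) : ℝ) : ℂ) •
        (hE.toDist f (schwartzTwist (-B) (latticePoint b m) ψ) •
          hE.ofSchwartz (schwartzTwist B (latticePoint b m) χ)) := by
  simp [TMIB.cesaroOp]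

variable [DiscreteTopology Λ] [IsZLattice ℝ Λ]

theorem exists_finset_integral_twist_eq_zero (b : Module.Basis (Fin n) ℤ Λ)
    (B : Matrix (Fin n) (Fin n) ℝ) {χ ρ : 𝓢(EuclideanSpace ℝ (Fin n), ℂ)}
    (hχ : HasCompactSupport χ) (hρ : HasCompactSupport ρ) :
    ∃ s : Finset (Fin n → ℤ),
      ∀ m ∉ s, ∫ t, schwartzTwist B (latticePoint b m) χ t * ρ t = 0 := by
  obtain ⟨R₁, hR₁, h₁⟩ := exists_apply_eq_zero_of_lt_norm hχ
  obtain ⟨R₂, hR₂, h₂⟩ := exists_apply_eq_zero_of_lt_norm hρ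
  obtain ⟨s, hs⟩ := exists_finset_latticePoint b (R₁ + R₂)
  refine ⟨s, fun m hm => integral_eq_zero_of_ae (Eventually.of_forall fun t => ?_)⟩
  rcases lt_or_ge R₂ ‖t‖ with h | h
  · simp [h₂ _ h]
  · have h5 := norm_sub_norm_le (latticePoint b m : EuclideanSpace ℝ (Fin n)) t
    rw [norm_sub_rev] at h5
    have h6 := hs m hm
    simp [schwartzTwist_apply', h₁ (t - latticePoint b m) (by linarith)]

/-- The operator `f ↦ ∑_λ ⟨f, T^{-B}_λ ψ⟩ T^B_λ χ` on `E`, as the strong limit of its Césaro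
means. -/
theorem TMIB.exists_frameOp (hE : TMIB n E) (b : Module.Basis (Fin n) ℤ Λ)
    (B : Matrix (Fin n) (Fin n) ℝ) {χ ψ : 𝓢(EuclideanSpace ℝ (Fin n), ℂ)}
    (hχ : HasCompactSupport χ) (hψ : HasCompactSupport ψ) :
    ∃ P : E →L[ℂ] E, (∀ f, Tendsto (fun N => hE.cesaroOp b B χ ψ N f) atTop (𝓝 (P f))) ∧
      ∀ f (ρ : 𝓢(EuclideanSpace ℝ (Fin n), ℂ)), HasCompactSupport ρ →
        HasSum (fun l : Λ => hE.toDist f (schwartzTwist (-B) l ψ) *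
          ∫ t, schwartzTwist B l χ t * ρ t) (hE.toDist (P f) ρ) := by
  -- The radius bounds all dual points with coordinates |θ_j| ≤ 1, the twists that occur in the
  -- Césaro averages.
  obtain ⟨C, hC0, hC⟩ := hE.exists_norm_sum_le b B hχ hψ (∑ j, ‖dualVec b j‖)
  have key : ∀ x ∈ (hE.testSubmodule : Set E), ∃ s : Finset (Fin n → ℤ),
      (∀ m ∉ s, hE.toDist x (schwartzTwist (-B) (latticePoint b m) ψ) •
          hE.ofSchwartz (schwartzTwist B (latticePoint b m) χ) = 0) ∧
      ∀ θ : Fin n → ℝ, (∀ j, |θ j| ≤ 1) → ‖∑ m ∈ s, expChar (-∑ j, θ j * m j) •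
        (hE.toDist x (schwartzTwist (-B) (latticePoint b m) ψ) •
          hE.ofSchwartz (schwartzTwist B (latticePoint b m) χ))‖ ≤ C * ‖x‖ := by
    rintro _ ⟨φ, hφ, rfl⟩
    obtain ⟨s, hs⟩ := exists_finset_integral_twist_eq_zero b (-B) hψ hφ
    refine ⟨s, fun m hm => ?_, fun θ hθ => ?_⟩
    · rw [hE.toDist_ofSchwartz', hs m hm, zero_smul]
    · have h1 : ‖dualPoint b θ‖ ≤ ∑ j, ‖dualVec b j‖ := by
        refine (norm_sum_le _ _).trans (Finset.sum_le_sum fun j _ => ?_)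
        rw [norm_smul]
        exact mul_le_of_le_one_left (norm_nonneg _) (hθ j)
      have h2 := hC (dualPoint b θ) h1 φ hφ s hs
      simpa only [inner_latticePoint_dualPoint, hE.toDist_ofSchwartz', smul_smul] using h2
  obtain ⟨P, hP⟩ := exists_tendsto_of_dense hE.dense_testSubmodule (hE.cesaroOp b B χ ψ) hC0
    (fun N x hx => by
      obtain ⟨s, hs, hb⟩ := key x hx
      rw [hE.cesaroOp_apply]
      exact norm_sum_cesaroBox_le hs (by positivity) hb N)
    (fun x hx => by
      obtain ⟨s, hs, -⟩ := key x hx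
      simp only [hE.cesaroOp_apply]
      exact ⟨_, tendsto_sum_cesaroBox hs⟩)
  refine ⟨P, hP, fun f ρ hρ => ?_⟩
  obtain ⟨s, hs⟩ := exists_finset_integral_twist_eq_zero b B hχ hρ
  have hz : ∀ m ∉ s, hE.toDist f (schwartzTwist (-B) (latticePoint b m) ψ) *
      ∫ t, schwartzTwist B (latticePoint b m) χ t * ρ t = 0 := fun m hm => by
    rw [hs m hm, mul_zero]
  -- Tested against ρ only finitely many terms survive, so the Césaro limit is the ordinary sum.
  have h1 := ((hE.evalCLM ρ).continuous.tendsto _).comp (hP f)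
  have h2 := h1.congr fun N => show hE.evalCLM ρ (hE.cesaroOp b B χ ψ N f) =
      ∑ m ∈ cesaroBox n N, ((∏ j, (1 - |(m j : ℝ)| / (N : ℝ)) : ℝ) : ℂ) •
        (hE.toDist f (schwartzTwist (-B) (latticePoint b m) ψ) *
          ∫ t, schwartzTwist B (latticePoint b m) χ t * ρ t) by
    rw [hE.cesaroOp_apply]
    simp only [map_sum, map_smul, smul_eq_mul, TMIB.evalCLM_apply, hE.toDist_ofSchwartz]
  rw [← TMIB.evalCLM_apply, tendsto_nhds_unique h2 (tendsto_sum_cesaroBox hz),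
    ← (latticeEquiv b).hasSum_iff]
  simpa [Function.comp_def] using hasSum_sum_of_ne_finset_zero hz

end Operators

/-! ### Dual windows and biorthogonality of the twisted translates. -/

section Biorthogonal

variable {n : ℕ} {Λ : Submodule ℤ (EuclideanSpace ℝ (Fin n))}
  {U : TopologicalSpace.Opens (EuclideanSpace ℝ (Fin n))}

/-- A test function as a Schwartz function. -/
def testToSchwartz (χ : 𝓓(U, ℂ)) : 𝓢(EuclideanSpace ℝ (Fin n), ℂ) :=
  χ.hasCompactSupport.toSchwartzMap χ.contDiff

@[simp] theorem testToSchwartz_apply (χ : 𝓓(U, ℂ)) (t : EuclideanSpace ℝ (Fin n)) :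
    testToSchwartz χ t = χ t := rfl

theorem hasCompactSupport_testToSchwartz (χ : 𝓓(U, ℂ)) : HasCompactSupport (testToSchwartz χ) :=
  χ.hasCompactSupport

theorem testToSchwartz_support (χ : 𝓓(U, ℂ)) {t : EuclideanSpace ℝ (Fin n)}
    (ht : testToSchwartz χ t ≠ 0) : t ∈ U :=
  χ.tsupport_subset (subset_tsupport _ ht)

theorem twistedTranslation_eq_schwartzTwist (B : Matrix (Fin n) (Fin n) ℝ) (χ : 𝓓(U, ℂ))
    (x t : EuclideanSpace ℝ (Fin n)) :
    twistedTranslation B x χ t = schwartzTwist B x (testToSchwartz χ) t :=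
  (schwartzTwist_apply B x t (testToSchwartz χ)).symm

theorem isSynthesis_iff (B : Matrix (Fin n) (Fin n) ℝ) (χ : 𝓓(U, ℂ)) (c : Λ → ℂ)
    (f : StrongDual ℂ 𝓢(EuclideanSpace ℝ (Fin n), ℂ)) :
    IsSynthesis B Λ χ c f ↔ ∀ φ : 𝓢(EuclideanSpace ℝ (Fin n), ℂ), HasCompactSupport φ →
      HasSum (fun l : Λ => c l * ∫ t, schwartzTwist B l (testToSchwartz χ) t * φ t) (f φ) := by
  simp only [IsSynthesis, twistedTranslation_eq_schwartzTwist]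

theorem exists_dual_window {χ : 𝓓(U, ℂ)} (hχ : χ ≠ 0) :
    ∃ ψ : 𝓢(EuclideanSpace ℝ (Fin n), ℂ), HasCompactSupport ψ ∧ (∀ t, ψ t ≠ 0 → t ∈ U) ∧
      ∫ t, testToSchwartz χ t * ψ t = 1 := by
  have hcs : ContDiff ℝ ∞ fun t => (starRingEnd ℂ) (χ t) := Complex.conjCLE.contDiff.comp χ.contDiff
  have hcc : HasCompactSupport fun t => (starRingEnd ℂ) (χ t) :=
    χ.hasCompactSupport.comp_left (g := starRingEnd ℂ) (map_zero _)
  set I : ℝ := ∫ t, ‖χ t‖ ^ 2 with hI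
  have hI0 : I ≠ 0 := by
    obtain ⟨t, ht⟩ : ∃ t, χ t ≠ 0 := by
      by_contra! h
      exact hχ (by ext t; simpa using h t)
    have hsc : HasCompactSupport fun t => ‖χ t‖ ^ 2 :=
      χ.hasCompactSupport.comp_left (g := fun z : ℂ => ‖z‖ ^ 2) (by simp)
    exact ((χ.contDiff.continuous.norm.pow 2).integral_pos_of_hasCompactSupport_nonneg_nonzero hsc
      (fun t => sq_nonneg _) (x := t) (by simpa using ht)).ne'
  -- The dual window is the complex conjugate of χ divided by its squared L² norm.
  refine ⟨((I : ℂ)⁻¹) • hcc.toSchwartzMap hcs, hcc.smul_left (f := fun _ => (I : ℂ)⁻¹),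
    fun t ht => ?_, ?_⟩
  · refine testToSchwartz_support χ fun h => ht ?_
    have h : χ t = 0 := h
    simp [h]
  · have : ∀ t, testToSchwartz χ t * (((I : ℂ)⁻¹) • hcc.toSchwartzMap hcs) t =
        (I : ℂ)⁻¹ * ((‖χ t‖ ^ 2 : ℝ) : ℂ) := by
      intro t
      simp only [testToSchwartz_apply, smul_apply, smul_eq_mul,
        HasCompactSupport.toSchwartzMap_toFun]
      push_cast
      rw [← Complex.mul_conj']
      ring
    simp only [this]
    rw [integral_const_mul, integral_complex_ofReal, ← hI]
    exact inv_mul_cancel₀ (by exact_mod_cast hI0)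

/-- For l = m the opposite twists cancel and a translation remains; for l ≠ m the supports lie in
disjoint translates of U. -/
theorem integral_twist_mul_twist
    (hUd : Pairwise fun l m : Λ =>
      Disjoint ((l : EuclideanSpace ℝ (Fin n)) +ᵥ (U : Set (EuclideanSpace ℝ (Fin n))))
        ((m : EuclideanSpace ℝ (Fin n)) +ᵥ (U : Set (EuclideanSpace ℝ (Fin n)))))
    (B : Matrix (Fin n) (Fin n) ℝ) {χ ψ : 𝓢(EuclideanSpace ℝ (Fin n), ℂ)}
    (hχ : ∀ t, χ t ≠ 0 → t ∈ U) (hψ : ∀ t, ψ t ≠ 0 → t ∈ U) (h1 : ∫ t, χ t * ψ t = 1) (l m : Λ) :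
    ∫ t, schwartzTwist B l χ t * schwartzTwist (-B) m ψ t = if l = m then 1 else 0 := by
  split_ifs with h
  · subst h
    rw [← h1, ← integral_sub_right_eq_self (fun t => χ t * ψ t) (l : EuclideanSpace ℝ (Fin n))]
    refine integral_congr_ae (Eventually.of_forall fun t => ?_)
    simp only [schwartzTwist_apply']
    have h2 := expChar_add (-inner ℝ (B.toEuclideanLin (l : EuclideanSpace ℝ (Fin n))) (t - l))
      (-inner ℝ ((-B).toEuclideanLin (l : EuclideanSpace ℝ (Fin n))) (t - l))
    simp only [map_neg, LinearMap.neg_apply, inner_neg_left, neg_neg, neg_add_cancel,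
      expChar_zero] at h2 ⊢
    linear_combination -(χ (t - l) * ψ (t - l)) * h2
  · refine integral_eq_zero_of_ae (Eventually.of_forall fun t => ?_)
    by_contra hne
    simp only [schwartzTwist_apply', Pi.zero_apply, mul_eq_zero, not_or] at hne
    have hsub : ∀ k : Λ, t - k ∈ U →
        t ∈ (k : EuclideanSpace ℝ (Fin n)) +ᵥ (U : Set (EuclideanSpace ℝ (Fin n))) := by
      intro k hk
      rw [Set.mem_vadd_set_iff_neg_vadd_mem, vadd_eq_add, neg_add_eq_sub]
      exact hk
    exact Set.disjoint_left.1 (hUd h) (hsub l (hχ _ hne.1.2)) (hsub m (hψ _ hne.2.2))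

/-- The coefficients of `S_χ(c)` are recovered by a dual window. -/
theorem IsSynthesis.apply_twist {B : Matrix (Fin n) (Fin n) ℝ} {χ : 𝓓(U, ℂ)} {c : Λ → ℂ}
    {f : StrongDual ℂ 𝓢(EuclideanSpace ℝ (Fin n), ℂ)} (h : IsSynthesis B Λ χ c f)
    (hUd : Pairwise fun l m : Λ =>
      Disjoint ((l : EuclideanSpace ℝ (Fin n)) +ᵥ (U : Set (EuclideanSpace ℝ (Fin n))))
        ((m : EuclideanSpace ℝ (Fin n)) +ᵥ (U : Set (EuclideanSpace ℝ (Fin n)))))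
    {ψ : 𝓢(EuclideanSpace ℝ (Fin n), ℂ)} (hψc : HasCompactSupport ψ) (hψ : ∀ t, ψ t ≠ 0 → t ∈ U)
    (h1 : ∫ t, testToSchwartz χ t * ψ t = 1) (m : Λ) : f (schwartzTwist (-B) m ψ) = c m := by
  rw [isSynthesis_iff] at h
  refine (h _ (hasCompactSupport_schwartzTwist (-B) m hψc)).unique ?_
  simp only [integral_twist_mul_twist hUd B (fun t => testToSchwartz_support χ) hψ h1]
  convert hasSum_single m (f := fun l : Λ => c l * if l = m then 1 else 0) ?_ using 1
  · simp
  · intro l hl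
    simp [hl]

end Biorthogonal

/-! ### Functionals on the discrete space, analysis map and pairing. -/

section Discrete

variable {n : ℕ} {Λ : Submodule ℤ (EuclideanSpace ℝ (Fin n))}
  {U : TopologicalSpace.Opens (EuclideanSpace ℝ (Fin n))}

section General

variable {X : Type*} [NormedAddCommGroup X] [NormedSpace ℂ X] {i : TemperedInclusion n X}
  {B : Matrix (Fin n) (Fin n) ℝ} {χ : EuclideanSpace ℝ (Fin n) → ℂ}

/-- The element of `X^B_d(Λ)` with prescribed entries and synthesis. -/
def DiscreteSpace.mk' (c : Λ → ℂ) (e : X) (h : IsSynthesis B Λ χ c (i.toDist e)) :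
    DiscreteSpace i B Λ χ := ⟨c, e, h⟩

@[simp] theorem DiscreteSpace.mk'_apply (c : Λ → ℂ) (e : X)
    (h : IsSynthesis B Λ χ c (i.toDist e)) (l : Λ) : DiscreteSpace.mk' c e h l = c l := rfl

@[simp] theorem DiscreteSpace.synthesis_mk' (c : Λ → ℂ) (e : X)
    (h : IsSynthesis B Λ χ c (i.toDist e)) :
    DiscreteSpace.synthesis i B Λ χ (DiscreteSpace.mk' c e h) = e :=
  IsSynthesis.unique (DiscreteSpace.isSynthesis_synthesis (DiscreteSpace.mk' c e h)) h

theorem DiscreteSpace.ext' {c d : DiscreteSpace i B Λ χ} (h : ∀ l, c l = d l) : c = d :=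
  Subtype.ext (funext h)

theorem DiscreteSpace.sum_apply {ι : Type*} (s : Finset ι) (c : ι → DiscreteSpace i B Λ χ)
    (l : Λ) : (∑ k ∈ s, c k) l = ∑ k ∈ s, c k l := by
  classical
  induction s using Finset.induction_on with
  | empty => rfl
  | insert a s ha ih => rw [Finset.sum_insert ha, Finset.sum_insert ha, ← ih]; rfl

/-- The synthesis map as a continuous linear map. -/
def DiscreteSpace.synthesisCLM (i : TemperedInclusion n X) (B : Matrix (Fin n) (Fin n) ℝ)
    (Λ : Submodule ℤ (EuclideanSpace ℝ (Fin n))) (χ : EuclideanSpace ℝ (Fin n) → ℂ) : DiscreteSpace i B Λ χ →L[ℂ] X :=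
  (DiscreteSpace.synthesis i B Λ χ).mkContinuous 1 fun c => by
    rw [one_mul, DiscreteSpace.norm_def]

end General

variable {E : Type*} [NormedAddCommGroup E] [NormedSpace ℂ E] [CompleteSpace E]

open Classical in
theorem TMIB.isSynthesis_single (hE : TMIB n E) (B : Matrix (Fin n) (Fin n) ℝ) (χ : 𝓓(U, ℂ))
    (l : Λ) : IsSynthesis B Λ χ (Pi.single l 1)
      (hE.toDist (hE.ofSchwartz (schwartzTwist B l (testToSchwartz χ)))) := by
  rw [isSynthesis_iff]
  intro φ _
  rw [hE.toDist_ofSchwartz]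
  convert hasSum_single l (f := fun m : Λ => (Pi.single l (1 : ℂ) : Λ → ℂ) m *
    ∫ t, schwartzTwist B m (testToSchwartz χ) t * φ t) ?_ using 1
  · simp
  · intro m hm
    simp [Pi.single_eq_of_ne hm]

open Classical in
/-- The unit sequences in `E^B_d(Λ)`. -/
def TMIB.unitSeq (hE : TMIB n E) (B : Matrix (Fin n) (Fin n) ℝ) (χ : 𝓓(U, ℂ)) (l : Λ) :
    DiscreteSpace hE.toTemperedInclusion B Λ χ :=
  DiscreteSpace.mk' _ _ (hE.isSynthesis_single B χ l)

open Classical in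
theorem TMIB.unitSeq_apply (hE : TMIB n E) (B : Matrix (Fin n) (Fin n) ℝ) (χ : 𝓓(U, ℂ))
    (l m : Λ) : hE.unitSeq B χ l m = if m = l then 1 else 0 := by
  rw [TMIB.unitSeq, DiscreteSpace.mk'_apply, Pi.single_apply]

theorem TMIB.synthesis_unitSeq (hE : TMIB n E) (B : Matrix (Fin n) (Fin n) ℝ) (χ : 𝓓(U, ℂ))
    (l : Λ) : DiscreteSpace.synthesis hE.toTemperedInclusion B Λ χ (hE.unitSeq B χ l) =
      hE.ofSchwartz (schwartzTwist B l (testToSchwartz χ)) :=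
  DiscreteSpace.synthesis_mk' _ _ _

variable [DiscreteTopology Λ] [IsZLattice ℝ Λ]

/-- A continuous functional on `E^B_d(Λ)` is the Césaro sum of its values on the unit sequences. -/
theorem TMIB.hasCesaroSum_dual (hE : TMIB n E) (B : Matrix (Fin n) (Fin n) ℝ)
    (hUd : Pairwise fun l m : Λ =>
      Disjoint ((l : EuclideanSpace ℝ (Fin n)) +ᵥ (U : Set (EuclideanSpace ℝ (Fin n))))
        ((m : EuclideanSpace ℝ (Fin n)) +ᵥ (U : Set (EuclideanSpace ℝ (Fin n)))))
    {χ : 𝓓(U, ℂ)} (hχ : χ ≠ 0) (b : Module.Basis (Fin n) ℤ Λ)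
    (L : StrongDual ℂ (DiscreteSpace hE.toTemperedInclusion B Λ χ))
    (c : DiscreteSpace hE.toTemperedInclusion B Λ χ) :
    HasCesaroSum b (fun l => L (hE.unitSeq B χ l) * c l) (L c) := by
  obtain ⟨ψ, hψc, hψ, h1⟩ := exists_dual_window hχ
  obtain ⟨P, hP, hPs⟩ := hE.exists_frameOp b B (hasCompactSupport_testToSchwartz χ) hψc
  have hcs := DiscreteSpace.isSynthesis_synthesis c
  set e := DiscreteSpace.synthesis hE.toTemperedInclusion B Λ χ c with he
  have hcoef : ∀ l : Λ, hE.toDist e (schwartzTwist (-B) l ψ) = c l := fun l =>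
    hcs.apply_twist hUd hψc hψ h1 l
  -- The coefficients of `e` against the dual window are the entries of `c`, so the frame operator
  -- resynthesizes `e`.
  have hPe : P e = e := by
    refine hE.eq_of_compactSupport fun ρ hρ => ?_
    have h2 := hPs e ρ hρ
    simp only [hcoef] at h2
    exact h2.unique ((isSynthesis_iff B χ c _).1 hcs ρ hρ)
  set cN : ℕ → DiscreteSpace hE.toTemperedInclusion B Λ χ := fun N =>
    ∑ m ∈ cesaroBox n N, ((∏ j, (1 - |(m j : ℝ)| / (N : ℝ)) : ℝ) : ℂ) •
      (c (latticePoint b m) • hE.unitSeq B χ (latticePoint b m)) with hcN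
  have hsyn : ∀ N, DiscreteSpace.synthesis hE.toTemperedInclusion B Λ χ (cN N) =
      hE.cesaroOp b B (testToSchwartz χ) ψ N e := by
    intro N
    rw [hE.cesaroOp_apply, hcN]
    simp only [map_sum, map_smul, hcoef, TMIB.synthesis_unitSeq]
  -- The norm of the discrete space is the norm of the synthesis in E, where the Césaro means
  -- converge by the choice of `P`.
  have hlim : Tendsto cN atTop (𝓝 c) := by
    rw [tendsto_iff_norm_sub_tendsto_zero]
    have h2 := tendsto_iff_norm_sub_tendsto_zero.1 (hP e)
    rw [hPe] at h2
    refine h2.congr fun N => ?_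
    rw [DiscreteSpace.norm_def, map_sub, hsyn, he]
  have h3 := (L.continuous.tendsto c).comp hlim
  rw [HasCesaroSum]
  refine h3.congr fun N => ?_
  simp only [Function.comp, hcN, map_sum, map_smul, smul_eq_mul]
  refine Finset.sum_congr rfl fun m _ => ?_
  rw [mul_comm (c _)]
  rfl

/-- The map `f ↦ (⟨f, T^{-B}_λ χ'⟩)_λ` from `E` to `E^B_d(Λ)`. -/
theorem TMIB.exists_analysis (hE : TMIB n E) (b : Module.Basis (Fin n) ℤ Λ)
    (B : Matrix (Fin n) (Fin n) ℝ) (χ χ' : 𝓓(U, ℂ)) :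
    ∃ Q : E →L[ℂ] DiscreteSpace hE.toTemperedInclusion B Λ χ, ∀ f (l : Λ),
      Q f l = hE.toDist f (schwartzTwist (-B) l (testToSchwartz χ')) := by
  obtain ⟨P, -, hPs⟩ := hE.exists_frameOp b B (hasCompactSupport_testToSchwartz χ)
    (hasCompactSupport_testToSchwartz χ')
  have hsyn : ∀ f, IsSynthesis B Λ χ
      (fun l : Λ => hE.toDist f (schwartzTwist (-B) l (testToSchwartz χ'))) (hE.toDist (P f)) :=
    fun f => (isSynthesis_iff B χ _ _).2 (hPs f)
  refine ⟨LinearMap.mkContinuous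
    { toFun := fun f => DiscreteSpace.mk' _ _ (hsyn f)
      map_add' := fun f g => DiscreteSpace.ext' fun l => by simp
      map_smul' := fun a f => DiscreteSpace.ext' fun l => by simp } ‖P‖ fun f => ?_,
    fun f l => rfl⟩
  change ‖DiscreteSpace.synthesis _ B Λ χ (DiscreteSpace.mk' _ _ (hsyn f))‖ ≤ _
  rw [DiscreteSpace.synthesis_mk']
  exact P.le_opNorm f

/-- For a test function φ the sequence Qφ is a finite combination of unit sequences, so L(Qφ) is the
finite sum of L(e_λ) ∫ T^{-B}_λ χ' φ. This is the adjoint of analysis with χ' acting as synthesis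
with χ'. -/
theorem TMIB.isSynthesis_comp_analysis (hE : TMIB n E) (b : Module.Basis (Fin n) ℤ Λ)
    {B : Matrix (Fin n) (Fin n) ℝ} {χ χ' : 𝓓(U, ℂ)}
    {Q : E →L[ℂ] DiscreteSpace hE.toTemperedInclusion B Λ χ}
    (hQ : ∀ f (l : Λ), Q f l = hE.toDist f (schwartzTwist (-B) l (testToSchwartz χ')))
    (L : StrongDual ℂ (DiscreteSpace hE.toTemperedInclusion B Λ χ)) :
    IsSynthesis (-B) Λ χ' (fun l => L (hE.unitSeq B χ l)) (hE.dual.toDist (L.comp Q)) := by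
  rw [isSynthesis_iff]
  intro φ hφ
  obtain ⟨s, hs⟩ := exists_finset_integral_twist_eq_zero b (-B)
    (hasCompactSupport_testToSchwartz χ') hφ
  rw [← (latticeEquiv b).hasSum_iff]
  have h1 : Q (hE.ofSchwartz φ) = ∑ m ∈ s,
      (∫ t, schwartzTwist (-B) (latticePoint b m) (testToSchwartz χ') t * φ t) •
        hE.unitSeq B χ (latticePoint b m) := by
    refine DiscreteSpace.ext' fun l => ?_
    obtain ⟨k, rfl⟩ := (latticeEquiv b).surjective l
    rw [hQ, hE.toDist_ofSchwartz', DiscreteSpace.sum_apply]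
    simp only [DiscreteSpace.smul_apply, TMIB.unitSeq_apply, ← latticeEquiv_apply,
      (latticeEquiv b).injective.eq_iff, mul_ite, mul_one, mul_zero]
    rw [Finset.sum_ite_eq]
    split_ifs with hk
    · rfl
    · simpa using hs k hk
  have h2 : hE.dual.toDist (L.comp Q) φ = ∑ m ∈ s, L (hE.unitSeq B χ (latticePoint b m)) *
      ∫ t, schwartzTwist (-B) (latticePoint b m) (testToSchwartz χ') t * φ t := by
    rw [TMIB.dual_toDist_apply, ContinuousLinearMap.comp_apply, h1, map_sum]
    simp only [map_smul, smul_eq_mul, mul_comm]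
  rw [h2]
  simpa [Function.comp_def] using hasSum_sum_of_ne_finset_zero
    (f := fun m : Fin n → ℤ => L (hE.unitSeq B χ (latticePoint b m)) *
      ∫ t, schwartzTwist (-B) (latticePoint b m) (testToSchwartz χ') t * φ t)
    fun m hm => by rw [hs m hm, mul_zero]

/-- The pairing of `(E')^{-B}_d(Λ)` with `E^B_d(Λ)`. -/
theorem TMIB.exists_pairing (hE : TMIB n E) (b : Module.Basis (Fin n) ℤ Λ)
    (B : Matrix (Fin n) (Fin n) ℝ)
    (hUd : Pairwise fun l m : Λ =>
      Disjoint ((l : EuclideanSpace ℝ (Fin n)) +ᵥ (U : Set (EuclideanSpace ℝ (Fin n))))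
        ((m : EuclideanSpace ℝ (Fin n)) +ᵥ (U : Set (EuclideanSpace ℝ (Fin n)))))
    {χ χ' : 𝓓(U, ℂ)} (hχ : χ ≠ 0) (hχ' : χ' ≠ 0) :
    ∃ Φ : DiscreteSpace hE.dual (-B) Λ χ' →L[ℂ]
        StrongDual ℂ (DiscreteSpace hE.toTemperedInclusion B Λ χ),
      ∀ (c' : DiscreteSpace hE.dual (-B) Λ χ') (l : Λ), Φ c' (hE.unitSeq B χ l) = c' l := by
  obtain ⟨ψ, hψc, hψ, h1⟩ := exists_dual_window hχ
  obtain ⟨ψ', hψc', hψ', h1'⟩ := exists_dual_window hχ'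
  -- Analysis with the dual window of χ and synthesis with the dual window of χ': `P` sends T^B_λ χ
  -- to T^B_λ ψ', on which S_{χ'}(c') takes the value c'_λ.
  obtain ⟨P, -, hPs⟩ := hE.exists_frameOp b B hψc' hψc
  refine ⟨(ContinuousLinearMap.precomp ℂ (P.comp
    (DiscreteSpace.synthesisCLM hE.toTemperedInclusion B Λ χ))).comp
      (DiscreteSpace.synthesisCLM hE.dual (-B) Λ χ'), fun c' l => ?_⟩
  change DiscreteSpace.synthesis hE.dual (-B) Λ χ' c'
    (P (DiscreteSpace.synthesis hE.toTemperedInclusion B Λ χ (hE.unitSeq B χ l))) = c' l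
  have h2 : P (hE.ofSchwartz (schwartzTwist B l (testToSchwartz χ))) =
      hE.ofSchwartz (schwartzTwist B l ψ') := by
    refine hE.eq_of_compactSupport fun ρ hρ => ?_
    refine (hPs _ ρ hρ).unique ?_
    simp only [hE.toDist_ofSchwartz, integral_twist_mul_twist hUd B
      (fun t => testToSchwartz_support χ) hψ h1]
    convert hasSum_single l (f := fun m : Λ => (if l = m then (1 : ℂ) else 0) *
      ∫ t, schwartzTwist B m ψ' t * ρ t) ?_ using 1
    · simp
    · intro m hm
      simp [hm.symm]
  rw [TMIB.synthesis_unitSeq, h2, ← TMIB.dual_toDist_apply]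
  have h3 := (DiscreteSpace.isSynthesis_synthesis c').apply_twist hUd hψc' hψ' h1' l
  rwa [neg_neg] at h3

end Discrete

/-! ### The duality theorem. -/

theorem exists_basis_zlattice {n : ℕ} (Λ : Submodule ℤ (EuclideanSpace ℝ (Fin n)))
    [DiscreteTopology Λ] [IsZLattice ℝ Λ] : Nonempty (Module.Basis (Fin n) ℤ Λ) := by
  have h : Module.finrank ℤ Λ = n := by rw [ZLattice.rank ℝ Λ]; simp
  have := ZLattice.module_free ℝ Λ
  have := ZLattice.module_finite ℝ Λ
  exact ⟨Module.finBasisOfFinrankEq ℤ Λ h⟩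

end

theorem proposition5p18 {n : ℕ} {E : Type*} [NormedAddCommGroup E] [NormedSpace ℂ E]
    [CompleteSpace E] (hE : TMIB n E) (B : Matrix (Fin n) (Fin n) ℝ)
    (Λ : Submodule ℤ (EuclideanSpace ℝ (Fin n))) [DiscreteTopology Λ] [IsZLattice ℝ Λ]
    (U : TopologicalSpace.Opens (EuclideanSpace ℝ (Fin n))) (hU0 : 0 ∈ U)
    (hUb : Bornology.IsBounded (U : Set (EuclideanSpace ℝ (Fin n))))
    (hUd : Pairwise fun l m : Λ =>
      Disjoint ((l : EuclideanSpace ℝ (Fin n)) +ᵥ (U : Set (EuclideanSpace ℝ (Fin n))))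
        ((m : EuclideanSpace ℝ (Fin n)) +ᵥ (U : Set (EuclideanSpace ℝ (Fin n)))))
    (χ χ' : 𝓓(U, ℂ)) (hχ : χ ≠ 0) (hχ' : χ' ≠ 0) :
    ∃ Φ : DiscreteSpace hE.dual (-B) Λ χ' ≃L[ℂ]
        StrongDual ℂ (DiscreteSpace hE.toTemperedInclusion B Λ χ),
      ∀ (b : Module.Basis (Fin n) ℤ Λ) (c' : DiscreteSpace hE.dual (-B) Λ χ')
        (c : DiscreteSpace hE.toTemperedInclusion B Λ χ),
        HasCesaroSum b (fun l => c' l * c l) (Φ c' c) := by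
  obtain ⟨b₀⟩ := exists_basis_zlattice Λ
  obtain ⟨Φ, hΦ⟩ := hE.exists_pairing b₀ B hUd hχ hχ'
  obtain ⟨Q, hQ⟩ := hE.exists_analysis b₀ B χ χ'
  have hinj : Function.Injective Φ := fun c d hcd =>
    DiscreteSpace.ext' fun l => by rw [← hΦ c l, hcd, hΦ d l]
  have hsyn : ∀ c' : DiscreteSpace hE.dual (-B) Λ χ', IsSynthesis (-B) Λ χ' c' (hE.dual.toDist ((Φ c').comp Q)) := by
    intro c'
    have h := hE.isSynthesis_comp_analysis b₀ hQ (Φ c')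
    simpa only [hΦ] using h
  have hsurj : Function.Surjective Φ := by
    intro L
    refine ⟨DiscreteSpace.mk' _ _ (hE.isSynthesis_comp_analysis b₀ hQ L), ?_⟩
    ext c
    -- Both functionals have the same values on the unit sequences, and these determine a continuous
    -- functional through its Césaro sums.
    have h1 := hE.hasCesaroSum_dual B hUd hχ b₀ L c
    have h2 := hE.hasCesaroSum_dual B hUd hχ b₀
      (Φ (DiscreteSpace.mk' _ _ (hE.isSynthesis_comp_analysis b₀ hQ L))) c
    simp only [hΦ] at h2
    exact tendsto_nhds_unique h2 h1
  -- By uniqueness of the synthesis, S_{χ'}(c') = Φ(c') ∘ Q, so boundedness of `Q` inverts the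
  -- estimate for `Φ`.
  have hbound : ∀ c' : DiscreteSpace hE.dual (-B) Λ χ', ‖c'‖ ≤ ‖Q‖ * ‖Φ c'‖ := by
    intro c'
    rw [DiscreteSpace.norm_def,
      IsSynthesis.unique (DiscreteSpace.isSynthesis_synthesis c') (hsyn c'), mul_comm]
    exact ContinuousLinearMap.opNorm_comp_le _ _
  set e : DiscreteSpace hE.dual (-B) Λ χ' ≃ₗ[ℂ]
      StrongDual ℂ (DiscreteSpace hE.toTemperedInclusion B Λ χ) :=
    LinearEquiv.ofBijective Φ.toLinearMap ⟨hinj, hsurj⟩ with he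
  refine ⟨e.toContinuousLinearEquivOfBounds ‖Φ‖ ‖Q‖ (fun c => Φ.le_opNorm c) (fun L => ?_),
    fun b c' c => ?_⟩
  · have h := hbound (e.symm L)
    have h2 : Φ (e.symm L) = L := e.apply_symm_apply L
    rwa [h2] at h
  -- `Φ` was built with the fixed basis `b₀`, yet its value is the Césaro sum for an arbitrary
  -- basis; this is the independence of A_Λ.
  · have h := hE.hasCesaroSum_dual B hUd hχ b (Φ c') c
    simp only [hΦ] at h
    exact h
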